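/- For a skew-symmetric real matrix $\theta=(\theta_{jk})\in M_n(\mathbb{R})$ let $A^n_\theta=C(\mathbb{T}^n_\theta)$ denote the noncommutative torus algebra, i.e. the universal unital $C^*$-algebra generated by unitaries $u_1,\dots,u_n$ subject to the relations $u_k u_j = e^{2\pi i\theta_{jk}}u_j u_k$ for $1\le j,k\le n$. For $r\in\mathbb{R}$ write $A^2_r$ for $A^2_\theta$ with $\theta=\begin{pmatrix}0&r\\-r&0\end{pmatrix}$. Let $\mathbb{T}^k=(\mathbb{S}^1)^k$, and let $\otimes$ denote the minimal (spatial) tensor product of $C^*$-algebras, the empty tensor product being $\mathbb{C}$. Let $n\ge 0$ be an integer and let $\theta\in M_n(\mathbb{Q})$ be skew-symmetric. Then there are integers $k,t\ge 0$ with $n=k+2t$ and rational numbers $\theta_1,\dots,\theta_t\in\mathbb{Q}$ such that $$A^n_\theta\;\cong\; C(\mathbb{T}^k)\otimes\bigotimes_{i=1}^t A^2_{\theta_i}$$ as $C^*$-algebras (i.e. there is a unital $*$-isomorphism). -/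

import Mathlib

open scoped TensorProduct Matrix

noncomputable section

namespace NCT

/-! ### C⋆-seminorms on a unital complex ⋆-algebra and the C⋆-algebras they generate -/

/-- A C⋆-seminorm on a unital complex ⋆-algebra. Together with submultiplicativity, the inequality
`p x * p x ≤ p (x⋆ * x)` is equivalent to the C⋆-identity. -/
structure CStarSeminorm (R : Type*) [Ring R] [StarRing R] [Algebra ℂ R]
    extends Seminorm ℂ R where
  mul_le' : ∀ x y : R, toFun (x * y) ≤ toFun x * toFun y
  mul_self_le' : ∀ x : R, toFun x * toFun x ≤ toFun (star x * x)

namespace CStarSeminorm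

variable {R : Type*} [Ring R] [StarRing R] [Algebra ℂ R]

instance : CoeFun (CStarSeminorm R) (fun _ => R → ℝ) := ⟨fun p => p.toSeminorm⟩

theorem mul_le (p : CStarSeminorm R) (x y : R) : p (x * y) ≤ p x * p y := p.mul_le' x y

theorem mul_self_le (p : CStarSeminorm R) (x : R) : p x * p x ≤ p (star x * x) :=
  p.mul_self_le' x

theorem nonneg (p : CStarSeminorm R) (x : R) : 0 ≤ p x := apply_nonneg p.toSeminorm x

theorem le_star (p : CStarSeminorm R) (x : R) : p x ≤ p (star x) := by
  rcases (p.nonneg x).eq_or_lt with h | h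
  · rw [← h]; exact p.nonneg _
  · exact le_of_mul_le_mul_right ((p.mul_self_le x).trans (p.mul_le _ _)) h

theorem star_eq (p : CStarSeminorm R) (x : R) : p (star x) = p x :=
  le_antisymm (by simpa using p.le_star (star x)) (p.le_star x)

/-- The zero C⋆-seminorm. -/
def zero (R : Type*) [Ring R] [StarRing R] [Algebra ℂ R] : CStarSeminorm R where
  toSeminorm := 0
  mul_le' x y := by
    change (0 : ℝ) ≤ 0 * 0
    simp
  mul_self_le' x := by
    change (0 : ℝ) * 0 ≤ 0
    simp

/-- The pointwise supremum of a nonempty, pointwise bounded set of C⋆-seminorms. -/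
def sup (S : Set (CStarSeminorm R)) (hne : S.Nonempty)
    (hb : ∀ x, ∃ M : ℝ, ∀ p ∈ S, p x ≤ M) : CStarSeminorm R :=
  have bdd : ∀ x, BddAbove (Set.range fun p : S => (p : CStarSeminorm R) x) := fun x => by
    obtain ⟨M, hM⟩ := hb x
    exact ⟨M, by rintro _ ⟨p, rfl⟩; exact hM p p.2⟩
  have : Nonempty S := hne.to_subtype
  have nn : ∀ x, 0 ≤ ⨆ p : S, (p : CStarSeminorm R) x :=
    fun x => Real.iSup_nonneg fun p => p.1.nonneg x
  { toSeminorm := Seminorm.of (fun x => ⨆ p : S, (p : CStarSeminorm R) x)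
      (fun x y => ciSup_le fun p => (map_add_le_add p.1.toSeminorm x y).trans
        (add_le_add (le_ciSup (bdd x) p) (le_ciSup (bdd y) p)))
      (fun a x => by
        rw [Real.mul_iSup_of_nonneg (norm_nonneg a)]
        exact iSup_congr fun p => map_smul_eq_mul p.1.toSeminorm a x)
    mul_le' := fun x y => ciSup_le fun p => (p.1.mul_le x y).trans
      (mul_le_mul (le_ciSup (bdd x) p) (le_ciSup (bdd y) p) (p.1.nonneg y) (nn x))
    mul_self_le' := fun x => by
      change (⨆ p : S, (p : CStarSeminorm R) x) * (⨆ p : S, (p : CStarSeminorm R) x) ≤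
        ⨆ p : S, (p : CStarSeminorm R) (star x * x)
      have h : (⨆ p : S, (p : CStarSeminorm R) x) ≤
          Real.sqrt (⨆ p : S, (p : CStarSeminorm R) (star x * x)) :=
        ciSup_le fun p => Real.le_sqrt_of_sq_le (by
          rw [sq]
          exact (p.1.mul_self_le x).trans (le_ciSup (bdd (star x * x)) p))
      calc _ ≤ _ := mul_le_mul h h (nn x) (Real.sqrt_nonneg _)
        _ = _ := Real.mul_self_sqrt (nn _) }

/-- A copy of the ⋆-algebra `R`, to be seminormed by `p`. -/
def Carrier (_ : CStarSeminorm R) : Type _ := R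

instance (p : CStarSeminorm R) : SeminormedRing p.Carrier :=
  { (AddGroupSeminorm.toSeminormedAddCommGroup (E := R) p.toSeminorm.toAddGroupSeminorm :
      SeminormedAddCommGroup p.Carrier),
    (inferInstanceAs (Ring R) : Ring p.Carrier) with
    norm_mul_le := p.mul_le' }

theorem norm_def (p : CStarSeminorm R) (x : p.Carrier) : ‖x‖ = p (show R from x) := rfl

instance (p : CStarSeminorm R) : StarRing p.Carrier :=
  (inferInstance : StarRing R)

instance (p : CStarSeminorm R) : NormedAlgebra ℂ p.Carrier :=
  { (inferInstance : Algebra ℂ R) with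
    norm_smul_le := fun a x => (map_smul_eq_mul p.toSeminorm a (show R from x)).le }

/-- The Hausdorff completion of `R` with respect to the C⋆-seminorm `p`: the quotient of `R` by the
null space of `p`, completed. -/
def Completion (p : CStarSeminorm R) : Type _ := UniformSpace.Completion p.Carrier

instance (p : CStarSeminorm R) : NormedRing p.Completion :=
  inferInstanceAs (NormedRing (UniformSpace.Completion p.Carrier))
instance (p : CStarSeminorm R) : CompleteSpace p.Completion :=
  inferInstanceAs (CompleteSpace (UniformSpace.Completion p.Carrier))
instance (p : CStarSeminorm R) : Algebra ℂ p.Completion :=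
  inferInstanceAs (Algebra ℂ (UniformSpace.Completion p.Carrier))

instance (p : CStarSeminorm R) : NormedAlgebra ℂ p.Completion where
  norm_smul_le a x := norm_smul_le a (show UniformSpace.Completion p.Carrier from x)

/-- The canonical map from `R` to its completion. -/
def incl (p : CStarSeminorm R) (x : R) : p.Completion :=
  ((show p.Carrier from x : p.Carrier) : UniformSpace.Completion p.Carrier)

theorem denseRange_incl (p : CStarSeminorm R) : DenseRange p.incl :=
  UniformSpace.Completion.denseRange_coe (α := p.Carrier)

theorem norm_incl (p : CStarSeminorm R) (x : R) : ‖p.incl x‖ = p x :=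
  UniformSpace.Completion.norm_coe (E := p.Carrier) x

theorem incl_add (p : CStarSeminorm R) (x y : R) : p.incl (x + y) = p.incl x + p.incl y :=
  UniformSpace.Completion.coe_add (α := p.Carrier) x y

theorem incl_mul (p : CStarSeminorm R) (x y : R) : p.incl (x * y) = p.incl x * p.incl y :=
  UniformSpace.Completion.coe_mul (α := p.Carrier) x y

theorem incl_one (p : CStarSeminorm R) : p.incl 1 = 1 := rfl

theorem incl_smul (p : CStarSeminorm R) (a : ℂ) (x : R) : p.incl (a • x) = a • p.incl x :=
  UniformSpace.Completion.coe_smul (X := p.Carrier) a x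

theorem isometry_star (p : CStarSeminorm R) : Isometry (star : p.Carrier → p.Carrier) :=
  Isometry.of_dist_eq fun x y => by
    rw [dist_eq_norm, dist_eq_norm]
    exact (congrArg p (star_sub (R := R) x y).symm).trans (p.star_eq _)

/-- The involution of the completion, extended by continuity from `R`. -/
instance (p : CStarSeminorm R) : Star p.Completion :=
  ⟨UniformSpace.Completion.map (star : p.Carrier → p.Carrier)⟩

theorem continuous_star' (p : CStarSeminorm R) :
    Continuous (star : p.Completion → p.Completion) :=
  UniformSpace.Completion.continuous_map

theorem incl_star (p : CStarSeminorm R) (x : R) : p.incl (star x) = star (p.incl x) :=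
  (UniformSpace.Completion.map_coe p.isometry_star.uniformContinuous (show p.Carrier from x)).symm

theorem ind (p : CStarSeminorm R) {P : p.Completion → Prop} (hc : IsClosed {x | P x})
    (h : ∀ x, P (p.incl x)) (x : p.Completion) : P x :=
  p.denseRange_incl.induction_on x hc h

theorem ind₂ (p : CStarSeminorm R) {P : p.Completion → p.Completion → Prop}
    (hc : IsClosed {x : p.Completion × p.Completion | P x.1 x.2})
    (h : ∀ x y, P (p.incl x) (p.incl y)) (x y : p.Completion) : P x y :=
  p.denseRange_incl.induction_on₂ hc h x y

instance (p : CStarSeminorm R) : StarRing p.Completion where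
  star_involutive := by
    refine p.ind (isClosed_eq (p.continuous_star'.comp p.continuous_star') continuous_id) ?_
    intro x
    rw [← incl_star, ← incl_star, star_star]
  star_mul := by
    refine p.ind₂ (isClosed_eq (p.continuous_star'.comp (continuous_fst.mul continuous_snd))
      ((p.continuous_star'.comp continuous_snd).mul (p.continuous_star'.comp continuous_fst))) ?_
    intro x y
    rw [← incl_mul, ← incl_star, star_mul, incl_mul, incl_star, incl_star]
  star_add := by
    refine p.ind₂ (isClosed_eq (p.continuous_star'.comp (continuous_fst.add continuous_snd))
      ((p.continuous_star'.comp continuous_fst).add (p.continuous_star'.comp continuous_snd))) ?_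
    intro x y
    rw [← incl_add, ← incl_star, star_add, incl_add, incl_star, incl_star]

instance (p : CStarSeminorm R) [StarModule ℂ R] : StarModule ℂ p.Completion where
  star_smul a := by
    refine p.ind (isClosed_eq (p.continuous_star'.comp (continuous_const_smul a))
      (p.continuous_star'.const_smul (star a))) ?_
    intro x
    rw [← incl_smul, ← incl_star, star_smul, incl_smul, incl_star]

instance (p : CStarSeminorm R) : CStarRing p.Completion where
  norm_mul_self_le := by
    refine p.ind (isClosed_le (continuous_norm.mul continuous_norm)
      (continuous_norm.comp (p.continuous_star'.mul continuous_id))) ?_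
    intro x
    rw [← incl_star, ← incl_mul, norm_incl, norm_incl]
    exact p.mul_self_le x

/-- The completion of a ⋆-algebra in a C⋆-seminorm is a C⋆-algebra. -/
instance (p : CStarSeminorm R) [StarModule ℂ R] : CStarAlgebra p.Completion where

end CStarSeminorm

/-! ### The group ⋆-algebra of a group -/

section GroupAlgebra

variable {G : Type*} [Group G]

/-- The involution of the complex group algebra: `(∑ c_g g)⋆ = ∑ conj(c_g) g⁻¹`. -/
instance : Star (MonoidAlgebra ℂ G) :=
  ⟨fun x => .ofCoeff ((x.coeff.mapRange star (star_zero ℂ)).mapDomain fun g => g⁻¹)⟩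

@[simp] theorem star_single (g : G) (c : ℂ) :
    star (MonoidAlgebra.single g c) = MonoidAlgebra.single g⁻¹ (star c) := by
  change MonoidAlgebra.ofCoeff _ = MonoidAlgebra.ofCoeff _
  simp

theorem groupAlgebra_star_add (x y : MonoidAlgebra ℂ G) : star (x + y) = star x + star y := by
  change MonoidAlgebra.ofCoeff _ = MonoidAlgebra.ofCoeff _ + MonoidAlgebra.ofCoeff _
  refine (congrArg MonoidAlgebra.ofCoeff ?_).trans (MonoidAlgebra.ofCoeff_add _ _)
  refine Eq.trans ?_ Finsupp.mapDomain_add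
  exact congrArg _ (Finsupp.mapRange_add star_add x.coeff y.coeff)

instance : StarRing (MonoidAlgebra ℂ G) where
  star_add := groupAlgebra_star_add
  star_involutive x := by
    induction x using MonoidAlgebra.induction_linear with
    | zero =>
      have h0 : star (0 : MonoidAlgebra ℂ G) = 0 := by simpa using star_single (1 : G) 0
      rw [h0, h0]
    | add x y hx hy => rw [groupAlgebra_star_add, groupAlgebra_star_add, hx, hy]
    | single g c => simp
  star_mul x y := by
    have h0 : star (0 : MonoidAlgebra ℂ G) = 0 := by simpa using star_single (1 : G) 0
    induction x using MonoidAlgebra.induction_linear with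
    | zero => simp [h0]
    | add x x' hx hx' => rw [add_mul, groupAlgebra_star_add, hx, hx', groupAlgebra_star_add,
        mul_add]
    | single g c =>
      induction y using MonoidAlgebra.induction_linear with
      | zero => simp [h0]
      | add y y' hy hy' => rw [mul_add, groupAlgebra_star_add, hy, hy', groupAlgebra_star_add,
          add_mul]
      | single h d => simp [mul_comm]

instance : StarModule ℂ (MonoidAlgebra ℂ G) where
  star_smul a x := by
    induction x using MonoidAlgebra.induction_linear with
    | zero => simp
    | add x y hx hy => rw [smul_add, star_add, hx, hy, star_add, smul_add]
    | single g c => simp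

theorem CStarSeminorm.one_le (p : CStarSeminorm (MonoidAlgebra ℂ G)) : p 1 ≤ 1 := by
  by_contra! h
  have h2 := p.mul_self_le 1
  rw [star_one, one_mul] at h2
  nlinarith

theorem CStarSeminorm.single_le (p : CStarSeminorm (MonoidAlgebra ℂ G)) (g : G) (c : ℂ) :
    p (MonoidAlgebra.single g c) ≤ ‖c‖ := by
  have h1 : p (MonoidAlgebra.single g 1) ≤ 1 := by
    have h := p.mul_self_le (MonoidAlgebra.single g 1)
    have e : star (MonoidAlgebra.single g (1 : ℂ)) * MonoidAlgebra.single g 1 = 1 := by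
      simp [MonoidAlgebra.one_def]
    rw [e] at h
    nlinarith [p.one_le, p.nonneg (MonoidAlgebra.single g 1)]
  have e : MonoidAlgebra.single g c = c • MonoidAlgebra.single g (1 : ℂ) := by simp
  rw [e]
  refine (map_smul_eq_mul p.toSeminorm c _).le.trans ?_
  exact mul_le_of_le_one_right (norm_nonneg c) h1

theorem groupAlgebra_bdd (x : MonoidAlgebra ℂ G) :
    ∃ M : ℝ, ∀ p : CStarSeminorm (MonoidAlgebra ℂ G), p x ≤ M := by
  induction x using MonoidAlgebra.induction_linear with
  | zero => exact ⟨0, fun p => (map_zero p.toSeminorm).le⟩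
  | add x y hx hy =>
    obtain ⟨M, hM⟩ := hx
    obtain ⟨N, hN⟩ := hy
    exact ⟨M + N, fun p => (map_add_le_add p.toSeminorm x y).trans (add_le_add (hM p) (hN p))⟩
  | single g c => exact ⟨‖c‖, fun p => p.single_le g c⟩

end GroupAlgebra

/-! ### Noncommutative tori -/

/-- The universal unital ⋆-algebra generated by `n` unitaries: the group algebra of the free group
on `n` generators. -/
abbrev FreeUnitaries (n : ℕ) : Type := MonoidAlgebra ℂ (FreeGroup (Fin n))

/-- The `j`-th free unitary generator. -/
def gen {n : ℕ} (j : Fin n) : FreeUnitaries n := MonoidAlgebra.single (FreeGroup.of j) 1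

/-- `e(x) = exp(2πix)`. -/
def e (x : ℝ) : ℂ := Complex.exp (2 * Real.pi * Complex.I * x)

/-- The C⋆-seminorms on the free ⋆-algebra on `n` unitaries in which the relations
`u_k u_j = e(θ_{jk}) u_j u_k` hold. -/
def torusSeminorms {n : ℕ} (θ : Matrix (Fin n) (Fin n) ℝ) : Set (CStarSeminorm (FreeUnitaries n)) :=
  {p | ∀ j k : Fin n, p (gen k * gen j - e (θ j k) • (gen j * gen k)) = 0}

/-- The largest C⋆-seminorm in which the relations of the noncommutative torus hold. -/
def torusSeminorm {n : ℕ} (θ : Matrix (Fin n) (Fin n) ℝ) : CStarSeminorm (FreeUnitaries n) :=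
  CStarSeminorm.sup (torusSeminorms θ) ⟨CStarSeminorm.zero _, fun _ _ => rfl⟩
    fun x => (groupAlgebra_bdd x).imp fun _ h p _ => h p

/-- The noncommutative torus algebra `A_θ^n = C(𝕋_θ^n)`: the universal unital C⋆-algebra generated
by unitaries `u_1, …, u_n` subject to `u_k u_j = e(θ_{jk}) u_j u_k`. -/
abbrev NCTorus {n : ℕ} (θ : Matrix (Fin n) (Fin n) ℝ) : Type := (torusSeminorm θ).Completion

/-! ### The minimal (spatial) tensor product of C⋆-algebras -/

section Tensor

variable {A B : Type} [CStarAlgebra A] [CStarAlgebra B]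

section Rep

variable {H K : Type} [NormedAddCommGroup H] [InnerProductSpace ℂ H] [CompleteSpace H]
  [NormedAddCommGroup K] [InnerProductSpace ℂ K] [CompleteSpace K]

/-- The tensor product `π ⊗ ρ` of two representations, as a linear map from the algebraic tensor
product `A ⊗ B` to the bounded operators on the pre-Hilbert space `H ⊗ K` (the bounded operators on
it have the same norm as their extensions to its Hilbert space completion). -/
def repTensor (π : A →⋆ₐ[ℂ] (H →L[ℂ] H)) (ρ : B →⋆ₐ[ℂ] (K →L[ℂ] K)) :
    A ⊗[ℂ] B →ₗ[ℂ] ((H ⊗[ℂ] K) →L[ℂ] (H ⊗[ℂ] K)) :=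
  TensorProduct.lift (LinearMap.mk₂ ℂ (fun a b => TensorProduct.mapL (π a) (ρ b))
    (fun a a' b => by rw [map_add, TensorProduct.mapL_add_left])
    (fun c a b => by rw [map_smul, TensorProduct.mapL_smul_left])
    (fun a b b' => by rw [map_add, TensorProduct.mapL_add_right])
    (fun c a b => by rw [map_smul, TensorProduct.mapL_smul_right]))

@[simp] theorem repTensor_tmul (π : A →⋆ₐ[ℂ] (H →L[ℂ] H)) (ρ : B →⋆ₐ[ℂ] (K →L[ℂ] K)) (a : A) (b : B) :
    repTensor π ρ (a ⊗ₜ b) = TensorProduct.mapL (π a) (ρ b) := rfl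

theorem repTensor_mul (π : A →⋆ₐ[ℂ] (H →L[ℂ] H)) (ρ : B →⋆ₐ[ℂ] (K →L[ℂ] K)) (x y : A ⊗[ℂ] B) :
    repTensor π ρ (x * y) = repTensor π ρ x * repTensor π ρ y := by
  induction x using TensorProduct.induction_on with
  | zero => simp
  | add x x' hx hx' => simp [add_mul, hx, hx']
  | tmul a b =>
    induction y using TensorProduct.induction_on with
    | zero => simp
    | add y y' hy hy' => simp [mul_add, hy, hy']
    | tmul a' b' => simp [TensorProduct.mapL_mul]

theorem inner_repTensor (π : A →⋆ₐ[ℂ] (H →L[ℂ] H)) (ρ : B →⋆ₐ[ℂ] (K →L[ℂ] K)) (x : A ⊗[ℂ] B)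
    (v w : H ⊗[ℂ] K) :
    inner ℂ (repTensor π ρ x v) w = inner ℂ v (repTensor π ρ (star x) w) := by
  induction x using TensorProduct.induction_on with
  | zero => simp
  | add x x' hx hx' => simp [inner_add_left, inner_add_right, hx, hx']
  | tmul a b =>
    induction v using TensorProduct.induction_on with
    | zero => simp
    | add v v' hv hv' => rw [map_add, inner_add_left, inner_add_left, hv, hv']
    | tmul h k =>
      induction w using TensorProduct.induction_on with
      | zero => simp
      | add w w' hw hw' => rw [map_add, inner_add_right, inner_add_right, hw, hw']
      | tmul h' k' =>
        simp [map_star, ContinuousLinearMap.star_eq_adjoint, ContinuousLinearMap.adjoint_inner_right]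

/-- The C⋆-seminorm `x ↦ ‖(π ⊗ ρ)(x)‖` on the algebraic tensor product. -/
def repSeminorm (π : A →⋆ₐ[ℂ] (H →L[ℂ] H)) (ρ : B →⋆ₐ[ℂ] (K →L[ℂ] K)) :
    CStarSeminorm (A ⊗[ℂ] B) where
  toSeminorm := Seminorm.ofSMulLE (fun x => ‖repTensor π ρ x‖)
    (by simp only [map_zero]; exact ContinuousLinearMap.opNorm_zero)
    (fun x y => by
      simp only [map_add]
      exact ContinuousLinearMap.opNorm_add_le _ _)
    (fun c x => by
      simp only [map_smul]
      exact ContinuousLinearMap.opNorm_smul_le _ _)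
  mul_le' x y := by
    change ‖repTensor π ρ (x * y)‖ ≤ ‖repTensor π ρ x‖ * ‖repTensor π ρ y‖
    rw [repTensor_mul]
    exact ContinuousLinearMap.opNorm_comp_le _ _
  mul_self_le' x := by
    change ‖repTensor π ρ x‖ * ‖repTensor π ρ x‖ ≤ ‖repTensor π ρ (star x * x)‖
    have h : ‖repTensor π ρ x‖ ≤ Real.sqrt ‖repTensor π ρ (star x * x)‖ := by
      refine ContinuousLinearMap.opNorm_le_bound _ (Real.sqrt_nonneg _) fun v => ?_
      refine le_of_sq_le_sq ?_ (by positivity)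
      rw [mul_pow, Real.sq_sqrt (ContinuousLinearMap.opNorm_nonneg _)]
      have h1 : ‖repTensor π ρ x v‖ ^ 2 = ‖inner ℂ v (repTensor π ρ (star x * x) v)‖ := by
        rw [repTensor_mul, mul_apply_eq_comp,
          ← inner_repTensor]
        have h2 := inner_self_eq_norm_sq_to_K (𝕜 := ℂ) (repTensor π ρ x v)
        refine Eq.trans ?_ (congrArg norm h2).symm
        simp
      rw [h1]
      calc _ ≤ ‖v‖ * ‖repTensor π ρ (star x * x) v‖ := norm_inner_le_norm _ _
        _ ≤ ‖v‖ * (‖repTensor π ρ (star x * x)‖ * ‖v‖) := by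
          gcongr; exact ContinuousLinearMap.le_opNorm _ _
        _ = _ := by ring
    calc _ ≤ _ := mul_le_mul h h (ContinuousLinearMap.opNorm_nonneg _) (Real.sqrt_nonneg _)
      _ = _ := Real.mul_self_sqrt (ContinuousLinearMap.opNorm_nonneg _)

end Rep

variable (A B)

/-- The C⋆-seminorms `x ↦ ‖(π ⊗ ρ)(x)‖` on `A ⊗ B`, for all representations `π` of `A` and `ρ` of
`B` on Hilbert spaces. -/
def spatialSeminorms : Set (CStarSeminorm (A ⊗[ℂ] B)) :=
  {p | ∃ (H : Type) (_ : NormedAddCommGroup H) (_ : InnerProductSpace ℂ H) (_ : CompleteSpace H)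
    (K : Type) (_ : NormedAddCommGroup K) (_ : InnerProductSpace ℂ K) (_ : CompleteSpace K)
    (π : A →⋆ₐ[ℂ] (H →L[ℂ] H)) (ρ : B →⋆ₐ[ℂ] (K →L[ℂ] K)), p = repSeminorm π ρ}

variable {A B}

theorem spatial_bdd (x : A ⊗[ℂ] B) : ∃ M : ℝ, ∀ p ∈ spatialSeminorms A B, p x ≤ M := by
  induction x using TensorProduct.induction_on with
  | zero => exact ⟨0, fun p _ => (map_zero p.toSeminorm).le⟩
  | add x y hx hy =>
    obtain ⟨M, hM⟩ := hx
    obtain ⟨N, hN⟩ := hy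
    exact ⟨M + N, fun p hp =>
      (map_add_le_add p.toSeminorm x y).trans (add_le_add (hM p hp) (hN p hp))⟩
  | tmul a b =>
    refine ⟨‖a‖ * ‖b‖, ?_⟩
    rintro _ ⟨H, _, _, _, K, _, _, _, π, ρ, rfl⟩
    change ‖TensorProduct.mapL (π a) (ρ b)‖ ≤ _
    exact (TensorProduct.norm_mapL_le _ _).trans (mul_le_mul
      (NonUnitalStarAlgHom.norm_apply_le π a) (NonUnitalStarAlgHom.norm_apply_le ρ b)
      (norm_nonneg _) (norm_nonneg _))

theorem spatial_nonempty : (spatialSeminorms A B).Nonempty :=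
  ⟨_, PUnit, inferInstance, inferInstance, inferInstance, PUnit, inferInstance, inferInstance,
    inferInstance,
    { toFun := fun _ => 0, map_one' := Subsingleton.elim _ _, map_mul' := fun _ _ => by simp,
      map_zero' := rfl, map_add' := fun _ _ => by simp,
      commutes' := fun _ => Subsingleton.elim _ _, map_star' := fun _ => by simp },
    { toFun := fun _ => 0, map_one' := Subsingleton.elim _ _, map_mul' := fun _ _ => by simp,
      map_zero' := rfl, map_add' := fun _ _ => by simp,
      commutes' := fun _ => Subsingleton.elim _ _, map_star' := fun _ => by simp }, rfl⟩

variable (A B)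

/-- The minimal (spatial) C⋆-norm on `A ⊗ B`: the supremum of `‖(π ⊗ ρ)(x)‖` over all
representations `π` of `A` and `ρ` of `B`. -/
def spatialSeminorm : CStarSeminorm (A ⊗[ℂ] B) :=
  CStarSeminorm.sup (spatialSeminorms A B) spatial_nonempty spatial_bdd

/-- The minimal (spatial) C⋆-tensor product of two unital C⋆-algebras. -/
abbrev CStarTensor : Type := (spatialSeminorm A B).Completion

end Tensor

/-- A unital C⋆-algebra, bundled. -/
structure CStarAlg where
  carrier : Type
  [str : CStarAlgebra carrier]

attribute [instance] CStarAlg.str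

/-- The C⋆-tensor product `A_1 ⊗ (A_2 ⊗ (⋯ ⊗ (A_t ⊗ ℂ)))` of a finite family; it is `ℂ` for the
empty family. -/
def bigTensor : (t : ℕ) → (Fin t → CStarAlg) → CStarAlg
  | 0, _ => ⟨ℂ⟩
  | t + 1, A => ⟨CStarTensor (A 0).carrier (bigTensor t fun i => A i.succ).carrier⟩

/-- The `2 × 2` skew-symmetric matrix with upper right entry `r`. -/
def skew2 (r : ℝ) : Matrix (Fin 2) (Fin 2) ℝ := !![0, r; -r, 0]

end NCT

end

/-! Write θ = B/N with B an integral alternating form on ℤⁿ. Over ℤ such a form is an orthogonal sum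
of planes, each an integer multiple of the standard symplectic form, and a zero form
(`exists_split_plane`, `exists_normal_form`); having a common denominator N is what makes this
available. A noncommutative torus depends only on the lattice with its form: its monomials are a
projective unitary representation of ℤⁿ with commutation phases e(B(x,y)/N), and a change of basis
merely selects other generators. The zero form gives C(𝕋ᵏ), a plane gives A² with parameter d/N, and
an orthogonal sum of forms gives a tensor product.

`QuantumTorus` makes this basis-free. Products are prescribed only up to a phase, so cocycles never
have to be compared. The tori, C(𝕋ᵏ), ℂ and spatial tensor products of quantum tori are all quantum
tori, and `QuantumTorus.nonempty_equiv` says that the form determines the algebra.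

For this uniqueness, the universal property maps a noncommutative torus onto any quantum torus with
the same form. Injectivity (`injective_of_map_u`) comes from averaging over the gauge action of the
compact torus: the average E has scalar values, is faithful on positive elements, and is compatible
with the map Φ. If Φ x = 0, then the scalar E(x⋆x) is sent to 0, so it vanishes provided the target
is nonzero, and faithfulness gives x = 0. Nonzero targets are guaranteed by clock and shift
matrices, which represent the rational torus on a finite-dimensional space; tensoring two such
representations shows that spatial tensor products are nonzero. -/

noncomputable section

namespace NCT

/-! ### Suprema of C⋆-seminorms and extension of ⋆-homomorphisms to completions -/

namespace CStarSeminorm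

variable {R : Type*} [Ring R] [StarRing R] [Algebra ℂ R]

theorem le_sup {S : Set (CStarSeminorm R)} (hne : S.Nonempty)
    (hb : ∀ x, ∃ M : ℝ, ∀ p ∈ S, p x ≤ M) {p : CStarSeminorm R} (hp : p ∈ S) (x : R) :
    p x ≤ sup S hne hb x := by
  obtain ⟨M, hM⟩ := hb x
  exact le_ciSup (f := fun p : S => (p : CStarSeminorm R) x)
    ⟨M, by rintro _ ⟨p, rfl⟩; exact hM p p.2⟩ ⟨p, hp⟩

theorem sup_le {S : Set (CStarSeminorm R)} (hne : S.Nonempty)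
    (hb : ∀ x, ∃ M : ℝ, ∀ p ∈ S, p x ≤ M) {x : R} {M : ℝ} (h : ∀ p ∈ S, p x ≤ M) :
    sup S hne hb x ≤ M :=
  have : Nonempty S := hne.to_subtype
  ciSup_le fun p : S => h p p.2

/-- The C⋆-seminorm pulled back from a C⋆-algebra along a ⋆-homomorphism. -/
def comap {B : Type*} [CStarAlgebra B] (f : R →⋆ₐ[ℂ] B) : CStarSeminorm R where
  toSeminorm := (normSeminorm ℂ B).comp f.toAlgHom.toLinearMap
  mul_le' x y := by
    change ‖f (x * y)‖ ≤ ‖f x‖ * ‖f y‖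
    rw [map_mul]; exact norm_mul_le _ _
  mul_self_le' x := by
    change ‖f x‖ * ‖f x‖ ≤ ‖f (star x * x)‖
    rw [map_mul, map_star, CStarRing.norm_star_mul_self]

theorem comap_apply {B : Type*} [CStarAlgebra B] (f : R →⋆ₐ[ℂ] B) (x : R) :
    comap f x = ‖f x‖ := rfl

section Lift

variable {B : Type*} [CStarAlgebra B] (p : CStarSeminorm R) (f : R →⋆ₐ[ℂ] B)

/-- The function underlying `CStarSeminorm.lift`. -/
def liftFun : p.Completion → B :=
  UniformSpace.Completion.extension (fun x : p.Carrier => f (show R from x))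

theorem uniformContinuous_carrier (hf : ∀ x, ‖f x‖ ≤ p x) :
    UniformContinuous (fun x : p.Carrier => f (show R from x)) :=
  (LipschitzWith.of_dist_le_mul (K := 1) fun x y => by
    rw [dist_eq_norm, dist_eq_norm, NNReal.coe_one, one_mul]
    exact (congrArg norm (map_sub f (show R from x) (show R from y))).symm.trans_le
      (hf _)).uniformContinuous

theorem continuous_liftFun : Continuous (liftFun p f) :=
  UniformSpace.Completion.continuous_extension

theorem liftFun_incl (hf : ∀ x, ‖f x‖ ≤ p x) (x : R) : liftFun p f (p.incl x) = f x :=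
  UniformSpace.Completion.extension_coe (uniformContinuous_carrier p f hf) (show p.Carrier from x)

variable [StarModule ℂ R]

/-- The canonical map to the completion, as a ⋆-homomorphism. -/
def inclHom (p : CStarSeminorm R) : R →⋆ₐ[ℂ] p.Completion where
  toFun := p.incl
  map_one' := p.incl_one
  map_mul' := p.incl_mul
  map_zero' := by simpa using p.incl_smul 0 0
  map_add' := p.incl_add
  commutes' c := by rw [Algebra.algebraMap_eq_smul_one, incl_smul, incl_one,
    Algebra.algebraMap_eq_smul_one]
  map_star' := p.incl_star

theorem inclHom_apply (p : CStarSeminorm R) (x : R) : p.inclHom x = p.incl x := rfl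

/-- The extension to the completion of a ⋆-homomorphism dominated by the seminorm. -/
def lift (hf : ∀ x, ‖f x‖ ≤ p x) : p.Completion →⋆ₐ[ℂ] B where
  toFun := liftFun p f
  map_one' := by rw [← p.incl_one, liftFun_incl p f hf, map_one]
  map_mul' := by
    have hc := continuous_liftFun p f
    refine p.ind₂ (isClosed_eq (hc.comp (continuous_fst.mul continuous_snd))
      ((hc.comp continuous_fst).mul (hc.comp continuous_snd))) fun x y => ?_
    rw [← incl_mul, liftFun_incl p f hf, liftFun_incl p f hf, liftFun_incl p f hf, map_mul]
  map_zero' := by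
    have h := liftFun_incl p f hf 0
    rwa [← inclHom_apply, map_zero, map_zero] at h
  map_add' := by
    have hc := continuous_liftFun p f
    refine p.ind₂ (isClosed_eq (hc.comp (continuous_fst.add continuous_snd))
      ((hc.comp continuous_fst).add (hc.comp continuous_snd))) fun x y => ?_
    rw [← incl_add, liftFun_incl p f hf, liftFun_incl p f hf, liftFun_incl p f hf, map_add]
  commutes' c := by
    have h := liftFun_incl p f hf (algebraMap ℂ R c)
    rw [← inclHom_apply] at h
    rwa [AlgHomClass.commutes, AlgHomClass.commutes] at h
  map_star' := by
    have hc := continuous_liftFun p f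
    refine p.ind (isClosed_eq (hc.comp p.continuous_star') (continuous_star.comp hc)) fun x => ?_
    rw [← incl_star, liftFun_incl p f hf, liftFun_incl p f hf, map_star]

@[simp] theorem lift_incl (hf : ∀ x, ‖f x‖ ≤ p x) (x : R) : p.lift f hf (p.incl x) = f x := liftFun_incl p f hf x

end Lift

end CStarSeminorm

/-! ### The universal property of noncommutative tori -/

section Universal

variable {n : ℕ} {B : Type*} [CStarAlgebra B]

/-- The ⋆-homomorphism from the group algebra given by a unitary representation. -/
def groupAlgebraLift {G : Type*} [Group G] (φ : G →* unitary B) : MonoidAlgebra ℂ G →⋆ₐ[ℂ] B :=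
  { MonoidAlgebra.lift ℂ B G ((unitary B).subtype.comp φ) with
    map_star' := fun x => by
      change MonoidAlgebra.lift ℂ B G ((unitary B).subtype.comp φ) (star x) =
        star (MonoidAlgebra.lift ℂ B G ((unitary B).subtype.comp φ) x)
      induction x using MonoidAlgebra.induction_linear with
      | zero => simp
      | add x y hx hy => rw [star_add, map_add, hx, hy, map_add, star_add]
      | single g c =>
        simp [MonoidAlgebra.lift_single, ← Unitary.star_eq_inv] }

@[simp] theorem groupAlgebraLift_single {G : Type*} [Group G] (φ : G →* unitary B) (g : G) (c : ℂ) :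
    groupAlgebraLift φ (MonoidAlgebra.single g c) = c • (φ g : B) :=
  MonoidAlgebra.lift_single _ _ _

/-- The ⋆-homomorphism from the free ⋆-algebra given by `n` unitaries. -/
def freeLift (v : Fin n → unitary B) : FreeUnitaries n →⋆ₐ[ℂ] B :=
  groupAlgebraLift (FreeGroup.lift v)

@[simp] theorem freeLift_gen (v : Fin n → unitary B) (j : Fin n) : freeLift v (gen j) = v j := by
  simp [freeLift, gen]

variable (θ : Matrix (Fin n) (Fin n) ℝ)

/-- The defining relations of the noncommutative torus. -/
def TorusRel (v : Fin n → unitary B) : Prop :=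
  ∀ j k, (v k : B) * v j = e (θ j k) • ((v j : B) * v k)

variable {θ}

/-- The universal property of `NCTorus θ`. -/
def NCTorus.lift (v : Fin n → unitary B) (hv : TorusRel θ v) : NCTorus θ →⋆ₐ[ℂ] B :=
  (torusSeminorm θ).lift (freeLift v) fun x =>
    -- The norm of B pulled back along `freeLift v` is a C⋆-seminorm killing the relators, hence one
    -- of those whose supremum defines the torus.
    CStarSeminorm.le_sup (p := CStarSeminorm.comap (freeLift v)) _ _ (fun j k => by
      rw [CStarSeminorm.comap_apply]
      simp [hv j k]) x

theorem NCTorus.lift_incl (v : Fin n → unitary B) (hv : TorusRel θ v) (x : FreeUnitaries n) :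
    NCTorus.lift v hv ((torusSeminorm θ).incl x) = freeLift v x :=
  CStarSeminorm.lift_incl _ _ _ x

variable (θ)

/-- The canonical representation of the free group in the noncommutative torus. -/
def NCTorus.word : FreeGroup (Fin n) →* unitary (NCTorus θ) :=
  MonoidHom.codRestrict ((torusSeminorm θ).inclHom.toAlgHom.toMonoidHom.comp
    (MonoidAlgebra.of ℂ (FreeGroup (Fin n)))) (unitary (NCTorus θ)) fun g => by
      have h (g : FreeGroup (Fin n)) : MonoidAlgebra.of ℂ (FreeGroup (Fin n)) g =
        MonoidAlgebra.single g 1 := rfl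
      change (torusSeminorm θ).inclHom (MonoidAlgebra.of ℂ _ g) ∈ _
      rw [h, Unitary.mem_iff, ← map_star, ← map_mul, ← map_mul]
      simp [← MonoidAlgebra.one_def]

theorem NCTorus.coe_word (g : FreeGroup (Fin n)) :
    (NCTorus.word θ g : NCTorus θ) = (torusSeminorm θ).incl (MonoidAlgebra.single g 1) := rfl

/-- The canonical generators of the noncommutative torus. -/
def NCTorus.u (j : Fin n) : unitary (NCTorus θ) := NCTorus.word θ (FreeGroup.of j)

/-- Every seminorm in the family vanishes on the relators, hence so does their supremum, and the
completion is Hausdorff. -/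
theorem NCTorus.torusRel : TorusRel θ (NCTorus.u θ) := fun j k => by
  have h : torusSeminorm θ (gen k * gen j - e (θ j k) • (gen j * gen k)) = 0 :=
    le_antisymm (CStarSeminorm.sup_le _ _ fun p hp => (hp j k).le) (CStarSeminorm.nonneg _ _)
  rw [← CStarSeminorm.norm_incl, norm_eq_zero, ← CStarSeminorm.inclHom_apply, map_sub, map_smul,
    map_mul, map_mul, sub_eq_zero] at h
  exact h

variable {θ}

@[simp] theorem NCTorus.lift_word (v : Fin n → unitary B) (hv : TorusRel θ v)
    (g : FreeGroup (Fin n)) : NCTorus.lift v hv (NCTorus.word θ g) = FreeGroup.lift v g := by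
  rw [coe_word, lift_incl]
  simp [freeLift]

@[simp] theorem NCTorus.lift_u (v : Fin n → unitary B) (hv : TorusRel θ v) (j : Fin n) :
    NCTorus.lift v hv (NCTorus.u θ j) = v j := by
  rw [u, lift_word, FreeGroup.lift_apply_of]

theorem NCTorus.mem_closure_span_word (x : NCTorus θ) :
    x ∈ closure (Submodule.span ℂ (Set.range fun g => (NCTorus.word θ g : NCTorus θ)) :
      Set (NCTorus θ)) := by
  refine CStarSeminorm.ind _ isClosed_closure (fun x => subset_closure ?_) x
  rw [← CStarSeminorm.inclHom_apply]
  induction x using MonoidAlgebra.induction_linear with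
  | zero => rw [map_zero]; exact Submodule.zero_mem _
  | add x y hx hy => rw [map_add]; exact Submodule.add_mem _ hx hy
  | single g c =>
    have h : MonoidAlgebra.single g c = c • MonoidAlgebra.single g (1 : ℂ) := by simp
    rw [h, map_smul]
    exact Submodule.smul_mem _ _ (Submodule.subset_span ⟨g, rfl⟩)

end Universal

/-! ### Averaging over a compact group of automorphisms -/

section Averaging

open MeasureTheory

theorem integrable_of_continuous {K E : Type*} [TopologicalSpace K] [CompactSpace K]
    [T2Space K]
    [MeasurableSpace K] [BorelSpace K] (μ : Measure K) [IsFiniteMeasure μ] [NormedAddCommGroup E]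
    {f : K → E} (hf : Continuous f) : Integrable f μ :=
  integrableOn_univ.mp (hf.continuousOn.integrableOn_compact isCompact_univ)

/-- A continuous function with nonnegative values in a C⋆-algebra and with vanishing integral
vanishes. -/
theorem eq_zero_of_integral_eq_zero {K T : Type*} [TopologicalSpace K] [CompactSpace K]
    [T2Space K] [MeasurableSpace K] [BorelSpace K] (μ : Measure K) [IsFiniteMeasure μ] [μ.IsOpenPosMeasure]
    [CStarAlgebra T] [PartialOrder T] [StarOrderedRing T] {b : K → T} (hb : Continuous b)
    (h0 : ∀ z, 0 ≤ b z) (hi : ∫ z, b z ∂μ = 0) (w : K) : b w = 0 := by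
  by_contra hw
  have hpos : 0 < ‖b w‖ := norm_pos_iff.mpr hw
  -- Near w one has b w ≤ b z + ε. Integrating over this neighbourhood U, of positive measure, and
  -- using ∫ b = 0 gives μ(U) b w ≤ μ(U) ε, so ‖b w‖ ≤ ‖b w‖ / 2.
  set ε := ‖b w‖ / 2 with hε
  set U : Set K := {z | ‖b w - b z‖ < ε}
  have hU : IsOpen U := isOpen_lt (continuous_const.sub hb).norm continuous_const
  have hwU : w ∈ U := by simp only [U, Set.mem_ofPred_eq, sub_self, norm_zero]; linarith
  have hμ : 0 < μ.real U :=
    ENNReal.toReal_pos (hU.measure_pos μ ⟨w, hwU⟩).ne' (measure_ne_top μ U)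
  have hint := integrable_of_continuous μ hb
  have hle : ∀ z ∈ U, b w ≤ b z + algebraMap ℝ T ε := fun z hz => by
    have hsa : IsSelfAdjoint (b w - b z) :=
      (IsSelfAdjoint.of_nonneg (h0 w)).sub (IsSelfAdjoint.of_nonneg (h0 z))
    have h2 : algebraMap ℝ T ‖b w - b z‖ ≤ algebraMap ℝ T ε :=
      algebraMap_mono T (le_of_lt hz)
    rw [← sub_le_iff_le_add']
    exact (IsSelfAdjoint.le_algebraMap_norm_self hsa).trans h2
  have h1 : ∫ z in U, b w ∂μ ≤ ∫ z in U, (b z + algebraMap ℝ T ε) ∂μ :=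
    integral_mono_ae (integrable_const _) (hint.integrableOn.add (integrable_const _))
      ((ae_restrict_iff' hU.measurableSet).mpr (Filter.Eventually.of_forall hle))
  have h2 : ∫ z in U, b z ∂μ ≤ ∫ z, b z ∂μ :=
    integral_mono_measure Measure.restrict_le_self (Filter.Eventually.of_forall h0) hint
  rw [integral_add hint.integrableOn (integrable_const _), setIntegral_const,
    setIntegral_const] at h1
  have h3 : μ.real U • b w ≤ μ.real U • algebraMap ℝ T ε := by
    refine h1.trans ?_
    rw [hi] at h2
    simpa using h2
  have h4 : b w ≤ algebraMap ℝ T ε := by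
    have := smul_le_smul_of_nonneg_left h3 (inv_nonneg.mpr hμ.le)
    rwa [inv_smul_smul₀ hμ.ne', inv_smul_smul₀ hμ.ne'] at this
  have h5 : ‖b w‖ ≤ ε := (CStarAlgebra.norm_le_iff_le_algebraMap _ (by linarith) (h0 w)).mpr h4
  linarith

theorem continuous_starAlgHom {A B : Type*} [CStarAlgebra A] [CStarAlgebra B] (f : A →⋆ₐ[ℂ] B) :
    Continuous f :=
  AddMonoidHomClass.continuous_of_bound f 1 fun a => by
    rw [one_mul]; exact NonUnitalStarAlgHom.norm_apply_le _ _

theorem closure_span_induction {A : Type*} [CStarAlgebra A] {S : Set A}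
    (hd : ∀ a, a ∈ closure (Submodule.span ℂ S : Set A)) {p : A → Prop} (hp : IsClosed {a | p a})
    (mem : ∀ a ∈ S, p a) (zero : p 0) (add : ∀ a b, p a → p b → p (a + b))
    (smul : ∀ (c : ℂ) a, p a → p (c • a)) (a : A) : p a := by
  refine closure_minimal (fun a ha => ?_) hp (hd a)
  induction ha using Submodule.span_induction with
  | mem a ha => exact mem a ha
  | zero => exact zero
  | add a b _ _ ha hb => exact add a b ha hb
  | smul c a _ ha => exact smul c a ha

/-- ⋆-homomorphisms of C⋆-algebras are contractive, so the maps γ z are equicontinuous, and an ε/3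
argument carries pointwise continuity from the span of S to its closure. -/
theorem continuous_apply_of_dense {K T : Type*} [TopologicalSpace K] [CStarAlgebra T]
    (γ : K → T →⋆ₐ[ℂ] T) (S : Set T)
    (hS : ∀ a ∈ S, Continuous fun z => γ z a)
    (hd : ∀ a, a ∈ closure (Submodule.span ℂ S : Set T)) (a : T) :
    Continuous fun z => γ z a := by
  have hspan : ∀ a ∈ Submodule.span ℂ S, Continuous fun z => γ z a := fun a ha => by
    induction ha using Submodule.span_induction with
    | mem a ha => exact hS a ha
    | zero => simpa using continuous_const
    | add a b _ _ ha hb =>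
      simp only [map_add]
      exact ha.add hb
    | smul c a _ ha =>
      simp only [map_smul]
      exact ha.const_smul c
  refine Metric.continuous_iff'.mpr fun w ε hε => ?_
  obtain ⟨b, hb, hab⟩ := Metric.mem_closure_iff.mp (hd a) (ε / 3) (by positivity)
  have hγ : ∀ z, dist (γ z a) (γ z b) ≤ dist a b := fun z => by
    rw [dist_eq_norm, dist_eq_norm, ← map_sub]
    exact NonUnitalStarAlgHom.norm_apply_le _ _
  filter_upwards [Metric.continuous_iff'.mp (hspan b hb) w (ε / 3) (by positivity)] with z hz
  have h1 := hγ z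
  have h2 := hγ w
  rw [dist_comm] at h2
  linarith [dist_triangle4 (γ z a) (γ z b) (γ w b) (γ w a)]

end Averaging

/-! ### Quantum tori over lattices -/

/-- The structure of a noncommutative torus with parameter form `B / N` on a C⋆-algebra `A`: a
projective unitary representation of the lattice `L` with dense span, commuting up to the
bicharacter of `B / N`, and equivariant under a gauge action of the dual group of `L`. -/
structure QuantumTorus (N : ℕ) {L : Type} [AddCommGroup L] (B : L →ₗ[ℤ] L →ₗ[ℤ] ℤ) (A : Type)
    [CStarAlgebra A] where
  alt : ∀ x, B x x = 0
  nontrivial : Nontrivial A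
  u : L → unitary A
  add : ∀ x y, ∃ c : Circle, (u (x + y) : A) = (c : ℂ) • ((u x : A) * u y)
  comm : ∀ x y, (u y : A) * u x = e ((B x y : ℝ) / N) • ((u x : A) * u y)
  gauge : ∀ χ : AddChar L Circle, ∃ α : A →⋆ₐ[ℂ] A, ∀ x, α (u x) = (χ x : ℂ) • (u x : A)
  dense : ∀ a, a ∈ closure (Submodule.span ℂ (Set.range fun x => (u x : A)) : Set A)

/-- The character of `ℤⁿ` given by a point of the torus. -/
def torusChar {n : ℕ} (z : Fin n → Circle) : AddChar (Fin n → ℤ) Circle where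
  toFun x := ∏ i, z i ^ x i
  map_zero_eq_one' := by simp
  map_add_eq_mul' x y := by simp [zpow_add, Finset.prod_mul_distrib]

theorem torusChar_apply {n : ℕ} (z : Fin n → Circle) (x : Fin n → ℤ) :
    torusChar z x = ∏ i, z i ^ x i := rfl

theorem torusChar_mul {n : ℕ} (z w : Fin n → Circle) (x : Fin n → ℤ) :
    torusChar (z * w) x = torusChar z x * torusChar w x := by
  simp [torusChar_apply, mul_zpow, Finset.prod_mul_distrib]

theorem continuous_torusChar {n : ℕ} (x : Fin n → ℤ) :
    Continuous fun z : Fin n → Circle => torusChar z x :=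
  continuous_finsetProd Finset.univ fun i _ =>
    (continuous_zpow (x i)).comp (continuous_apply (A := fun _ : Fin n => Circle) i)

@[simp] theorem torusChar_single {n : ℕ} (z : Fin n → Circle) (j : Fin n) :
    torusChar z (Pi.single j 1) = z j := by
  rw [torusChar_apply, Finset.prod_eq_single j] <;> simp +contextual

theorem exists_torusChar_ne_one {n : ℕ} {x : Fin n → ℤ} (hx : x ≠ 0) :
    ∃ z : Fin n → Circle, torusChar z x ≠ 1 := by
  obtain ⟨j, hj⟩ := Function.ne_iff.mp hx
  -- Only the j-th coordinate differs from 1, and its power with exponent x j is exp(iπ) = -1.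
  refine ⟨Pi.mulSingle j (Circle.exp (Real.pi / x j)), ?_⟩
  rw [torusChar_apply, Finset.prod_eq_single j]
  · have hj' : (x j : ℝ) ≠ 0 := by exact_mod_cast hj
    rw [Pi.mulSingle_eq_same, ← Circle.exp_zsmul, zsmul_eq_mul, mul_div_cancel₀ _ hj']
    intro h
    have := congrArg (fun c : Circle => (c : ℂ)) h
    norm_num [Circle.coe_exp] at this
  · intro i _ hi
    simp [Pi.mulSingle_eq_of_ne hi]
  · simp

open MeasureTheory in
-- Translating by a point w where the character is not 1 multiplies the integral by that value while
-- leaving it unchanged.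
theorem integral_torusChar {n : ℕ} [MeasurableSpace (Fin n → Circle)] [BorelSpace (Fin n → Circle)]
    (μ : Measure (Fin n → Circle)) [μ.IsMulLeftInvariant] {x : Fin n → ℤ} (hx : x ≠ 0) :
    ∫ z, (torusChar z x : ℂ) ∂μ = 0 := by
  obtain ⟨w, hw⟩ := exists_torusChar_ne_one hx
  have h := integral_mul_left_eq_self (μ := μ) (fun z => (torusChar z x : ℂ)) w
  simp only [torusChar_mul, Circle.coe_mul] at h
  rw [integral_const_mul] at h
  have h' : ((torusChar w x : ℂ) - 1) * ∫ z, (torusChar z x : ℂ) ∂μ = 0 := by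
    rw [sub_mul, h, one_mul, sub_self]
  refine (mul_eq_zero.mp h').resolve_left fun h0 => hw ?_
  exact Circle.ext (sub_eq_zero.mp h0)

namespace QuantumTorus

variable {N : ℕ} {L : Type} [AddCommGroup L] {B : L →ₗ[ℤ] L →ₗ[ℤ] ℤ} {A : Type} [CStarAlgebra A]

/-- Additivity up to phase at 0 + 0 reads u 0 = c (u 0)²; cancel the unitary u 0. -/
theorem exists_one_eq (Q : QuantumTorus N B A) : ∃ c : Circle, (1 : A) = (c : ℂ) • (Q.u 0 : A) := by
  obtain ⟨c, hc⟩ := Q.add 0 0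
  rw [add_zero] at hc
  refine ⟨c, ?_⟩
  have := congrArg (fun a => star (Q.u 0 : A) * a) hc
  simpa [← mul_assoc] using this

/-- A unital ⋆-homomorphism of quantum tori respecting the projective representations is
injective. -/
theorem injective_of_map_u {n : ℕ} {B B' : (Fin n → ℤ) →ₗ[ℤ] (Fin n → ℤ) →ₗ[ℤ] ℤ} {T : Type}
    [CStarAlgebra T] (P : QuantumTorus N B T) (Q : QuantumTorus N B' A) (Φ : T →⋆ₐ[ℂ] A)
    (hΦ : ∀ x, ∃ c : ℂ, Φ (P.u x) = c • (Q.u x : A)) : Function.Injective Φ := by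
  let _ : MeasurableSpace (Fin n → Circle) := borel _
  have : BorelSpace (Fin n → Circle) := ⟨rfl⟩
  let μ : MeasureTheory.Measure (Fin n → Circle) := MeasureTheory.Measure.haar
  let _ : PartialOrder T := CStarAlgebra.spectralOrder T
  have : StarOrderedRing T := CStarAlgebra.spectralOrderedRing T
  have := Q.nontrivial
  choose γ hγ using fun z : Fin n → Circle => P.gauge (torusChar z)
  choose β hβ using fun z : Fin n → Circle => Q.gauge (torusChar z)
  have hcont : ∀ a, Continuous fun z => γ z a := by
    refine continuous_apply_of_dense γ _ ?_ P.dense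
    rintro _ ⟨x, rfl⟩
    simp only [hγ]
    exact (continuous_subtype_val.comp (continuous_torusChar x)).smul continuous_const
  have hint : ∀ a, MeasureTheory.Integrable (fun z => γ z a) μ :=
    fun a => integrable_of_continuous μ (hcont a)
  have hcΦ : Continuous Φ := continuous_starAlgHom Φ
  -- Φ intertwines the two gauge actions, since it sends each P.u x to a multiple of Q.u x and both
  -- actions scale these by the same character value.
  have hequiv : ∀ z a, Φ (γ z a) = β z (Φ a) := fun z => by
    refine closure_span_induction P.dense
      (isClosed_eq (hcΦ.comp (continuous_starAlgHom (γ z)))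
        ((continuous_starAlgHom (β z)).comp hcΦ)) ?_ (by simp) ?_ ?_
    · rintro _ ⟨x, rfl⟩
      obtain ⟨c, hc⟩ := hΦ x
      rw [hγ, map_smul, hc, map_smul, hβ, smul_comm]
    · intro a b ha hb; simp only [map_add, ha, hb]
    · intro c a ha; simp only [map_smul, ha]
  -- The γ z are merely chosen, so nothing makes γ a group homomorphism; density shows at least that
  -- γ 1 is the identity, which is all that is needed.
  have hone : ∀ a, γ 1 a = a := by
    refine closure_span_induction P.dense
      (isClosed_eq (continuous_starAlgHom (γ 1)) continuous_id) ?_ (by simp) ?_ ?_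
    · rintro _ ⟨x, rfl⟩; simp [hγ, torusChar_apply]
    · intro a b ha hb; rw [map_add, ha, hb]
    · intro c a ha; rw [map_smul, ha]
  let E : T → T := fun a => ∫ z, γ z a ∂μ
  have hEcont : Continuous E := by
    -- The Haar measure is not assumed normalised, so the Lipschitz constant is its total mass.
    refine (LipschitzWith.of_dist_le_mul (K := ⟨μ.real Set.univ, MeasureTheory.measureReal_nonneg⟩)
      fun a b => ?_).continuous
    rw [dist_eq_norm, dist_eq_norm, ← MeasureTheory.integral_sub (hint a) (hint b)]
    refine (MeasureTheory.norm_integral_le_of_norm_le_const (C := ‖a - b‖)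
      (Filter.Eventually.of_forall fun z => ?_)).trans_eq (mul_comm _ _)
    rw [← map_sub]
    exact NonUnitalStarAlgHom.norm_apply_le _ _
  -- Averaging kills P.u x for x ≠ 0, because its character has integral 0, and P.u 0 is a scalar.
  have hscalar : ∀ a, E a ∈ Submodule.span ℂ {(1 : T)} := by
    refine closure_span_induction P.dense
      ((Submodule.closed_of_finiteDimensional (Submodule.span ℂ {(1 : T)})).preimage hEcont)
      ?_ ?_ ?_ ?_
    · rintro _ ⟨x, rfl⟩
      have hx : E (P.u x) = (∫ z, (torusChar z x : ℂ) ∂μ) • (P.u x : T) := by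
        simp only [E, hγ]
        exact integral_smul_const _ _
      rw [hx]
      by_cases h : x = 0
      · obtain ⟨c, hc⟩ := P.exists_one_eq
        have hu : (P.u 0 : T) = (c : ℂ)⁻¹ • 1 := by rw [hc, inv_smul_smul₀ (Circle.coe_ne_zero c)]
        rw [h, hu]
        exact Submodule.smul_mem _ _ (Submodule.smul_mem _ _ (Submodule.mem_span_singleton_self _))
      · rw [integral_torusChar μ h, zero_smul]
        exact Submodule.zero_mem _
    · simp [E]
    · intro a b ha hb
      have : E (a + b) = E a + E b := by
        simp only [E, map_add]
        exact MeasureTheory.integral_add (hint a) (hint b)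
      rw [this]
      exact Submodule.add_mem _ ha hb
    · intro c a ha
      have : E (c • a) = c • E a := by
        simp only [E, map_smul]
        exact MeasureTheory.integral_smul _ _
      rw [this]
      exact Submodule.smul_mem _ _ ha
  refine (injective_iff_map_eq_zero Φ).mpr fun x hx => ?_
  -- Φ passes under the integral, where equivariance and Φ x = 0 make the integrand vanish. As E
  -- (x⋆x) = c • 1 and Φ is unital into a nonzero algebra, c = 0.
  have hE : E (star x * x) = 0 := by
    obtain ⟨c, hc⟩ := Submodule.mem_span_singleton.mp (hscalar (star x * x))
    have h1 : Φ (E (star x * x)) = 0 := by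
      have h2 := (ContinuousLinearMap.integral_comp_comm
        (⟨Φ.toAlgHom.toLinearMap, hcΦ⟩ : T →L[ℂ] A) (hint (star x * x))).symm
      refine h2.trans (MeasureTheory.integral_eq_zero_of_ae (Filter.Eventually.of_forall fun z => ?_))
      change Φ (γ z (star x * x)) = 0
      rw [hequiv, map_mul, hx, mul_zero, map_zero]
    rw [← hc, map_smul, map_one] at h1
    have hc0 : c = 0 := by simpa using h1
    rw [← hc, hc0, zero_smul]
  have h := eq_zero_of_integral_eq_zero μ (hcont (star x * x))
    (fun z => by rw [map_mul, map_star]; exact star_mul_self_nonneg _) hE 1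
  rw [hone] at h
  exact (CStarRing.star_mul_self_eq_zero_iff x).mp h

end QuantumTorus

/-! ### Phases -/

theorem coe_circleExp_two_pi (x : ℝ) : (Circle.exp (2 * Real.pi * x) : ℂ) = e x := by
  rw [Circle.coe_exp, e]
  congr 1
  push_cast
  ring

/-- The character `x ↦ e(f(x) / N)` given by an integral functional `f`. -/
def phase (N : ℕ) {L : Type} [AddCommGroup L] (f : L →+ ℤ) : AddChar L Circle where
  toFun x := Circle.exp (2 * Real.pi * ((f x : ℝ) / N))
  map_zero_eq_one' := by simp
  map_add_eq_mul' x y := by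
    rw [← Circle.exp_add]
    congr 1
    push_cast [map_add]
    ring

theorem coe_phase (N : ℕ) {L : Type} [AddCommGroup L] (f : L →+ ℤ) (x : L) :
    (phase N f x : ℂ) = e ((f x : ℝ) / N) := coe_circleExp_two_pi _

/-- Multiply by `star v` on both sides. This lets a commutation relation be read with either factor
in the role of the conjugating unitary. -/
theorem mul_unitary_eq_smul_iff {A : Type*} [CStarAlgebra A] (v : unitary A) (a : A) (c : ℂ) :
    a * v = c • (v * a) ↔ star (v : A) * a = c • (a * star (v : A)) := by
  have h1 := Unitary.mul_star_self_of_mem v.2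
  have h2 := Unitary.star_mul_self_of_mem v.2
  constructor <;> intro h
  · calc star (v : A) * a = star (v : A) * (a * v) * star (v : A) := by
          rw [mul_assoc, mul_assoc, h1, mul_one]
      _ = _ := by rw [h, mul_smul_comm, smul_mul_assoc, ← mul_assoc, h2, one_mul]
  · calc a * v = v * (star (v : A) * a) * v := by rw [← mul_assoc, h1, one_mul]
      _ = _ := by rw [h, mul_smul_comm, smul_mul_assoc, mul_assoc, mul_assoc a, h2, mul_one]

/-- The scalar unitaries of a C⋆-algebra. -/
def circleUnitary (A : Type*) [CStarAlgebra A] : Circle →* unitary A where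
  toFun c := ⟨(c : ℂ) • 1, by
    rw [Unitary.mem_iff]
    simp [smul_smul, ← Circle.coe_inv_eq_conj]⟩
  map_one' := Subtype.ext (by simp)
  map_mul' c d := Subtype.ext (by simp [smul_smul, mul_comm])

@[simp] theorem coe_circleUnitary {A : Type*} [CStarAlgebra A] (c : Circle) :
    (circleUnitary A c : A) = (c : ℂ) • 1 := rfl

theorem coe_circleUnitary_mul {A : Type*} [CStarAlgebra A] (c : Circle) (v : unitary A) :
    ((circleUnitary A c * v : unitary A) : A) = (c : ℂ) • (v : A) := by
  rw [Submonoid.coe_mul, coe_circleUnitary, smul_mul_assoc, one_mul]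

/-! ### Clock and shift matrices -/

section ClockShift

variable {G : Type} [AddCommGroup G] [Fintype G] [DecidableEq G]

/-- The weighted translation matrix `f ↦ (m ↦ c m * f (m + g))`. -/
def weightedShift (c : G → Circle) (g : G) : Matrix G G ℂ :=
  Matrix.of fun m m' => if m' = m + g then (c m : ℂ) else 0

theorem weightedShift_mul (c c' : G → Circle) (g g' : G) :
    weightedShift c g * weightedShift c' g' =
      weightedShift (fun m => c m * c' (m + g)) (g + g') := by
  ext m m'
  simp only [weightedShift, Matrix.mul_apply, Matrix.of_apply, ite_mul, zero_mul, mul_ite,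
    mul_zero, ← add_assoc, Circle.coe_mul]
  rw [Finset.sum_eq_single (m + g)] <;> simp +contextual

theorem weightedShift_mem_unitary (c : G → Circle) (g : G) :
    weightedShift c g ∈ unitary (Matrix G G ℂ) := by
  have h : star (weightedShift c g) = weightedShift (fun m => (c (m - g))⁻¹) (-g) := by
    ext m m'
    simp only [weightedShift, Matrix.star_apply, Matrix.of_apply]
    by_cases h : m = m' + g
    · have h' : m' = m + -g := by rw [h]; abel
      rw [if_pos h, if_pos h', h', ← sub_eq_add_neg, Circle.coe_inv_eq_conj]
      rfl
    · have h' : ¬ m' = m + -g := fun h' => h (by rw [h']; abel)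
      rw [if_neg h, if_neg h', star_zero]
  have h1 : weightedShift (fun _ : G => 1) 0 = 1 := by
    ext m m'
    simp [weightedShift, Matrix.one_apply, eq_comm]
  rw [Unitary.mem_iff, h, weightedShift_mul, weightedShift_mul]
  constructor <;> simpa [sub_eq_add_neg] using h1

variable {n : ℕ} (N : ℕ) [NeZero N] (M : Fin n → Fin n → ℤ)

/-- The representation space of the clock and shift matrices. -/
abbrev ClockSpace (n N : ℕ) [NeZero N] : Type := EuclideanSpace ℂ (Fin n → ZMod N)

/-- The weights of the clock and shift matrices. -/
def clockWeight (j : Fin n) (m : Fin n → ZMod N) : Circle :=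
  ZMod.toCircle (∑ k, (if j < k then (M j k : ZMod N) else 0) * m k)

/-- Weights use only the entries of M above the diagonal, so exactly one of the two orders of a pair
of distinct generators picks up a phase. -/
theorem clockWeight_add_single (j k : Fin n) (m : Fin n → ZMod N) :
    clockWeight N M j (m + Pi.single k 1) =
      clockWeight N M j m * ZMod.toCircle (if j < k then (M j k : ZMod N) else 0) := by
  rw [clockWeight, clockWeight, ← AddChar.map_add_eq_mul]
  congr 1
  simp [mul_add, Finset.sum_add_distrib, Pi.single_apply]

/-- The clock and shift operators. -/
def clockUnitary (j : Fin n) : unitary (ClockSpace n N →L[ℂ] ClockSpace n N) :=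
  ⟨Matrix.toEuclideanCLM (𝕜 := ℂ) (weightedShift (clockWeight N M j) (Pi.single j 1)), by
    have h := weightedShift_mem_unitary (clockWeight N M j) (Pi.single j 1)
    rw [Unitary.mem_iff] at h ⊢
    rw [← map_star, ← map_mul, ← map_mul, h.1, h.2, map_one]
    exact ⟨rfl, rfl⟩⟩

theorem toCircle_intCast_eq_e (j : ℤ) : (ZMod.toCircle (j : ZMod N) : ℂ) = e ((j : ℝ) / N) := by
  rw [ZMod.toCircle_intCast, e]
  congr 1
  push_cast
  ring

/-- Both products translate by the same vector, so only weights are compared. Their ratio has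
exponent M j k if j < k and -M k j if k < j; skew-symmetry makes both equal to M j k. -/
theorem torusRel_clockUnitary (hM : ∀ j k, M j k = -M k j) :
    TorusRel (fun j k => (M j k : ℝ) / N) (clockUnitary N M) := fun j k => by
  simp only [clockUnitary]
  rw [← map_mul, ← map_mul, ← map_smul, weightedShift_mul, weightedShift_mul]
  congr 1
  ext m m'
  simp only [weightedShift, Matrix.of_apply, Matrix.smul_apply,
    add_comm (Pi.single j 1 : Fin n → ZMod N)]
  split_ifs
  · have h : (ZMod.toCircle (if j < k then (M j k : ZMod N) else 0)) =
        ZMod.toCircle (M j k : ZMod N) * ZMod.toCircle (if k < j then (M k j : ZMod N) else 0) := by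
      rw [← AddChar.map_add_eq_mul]
      congr 1
      rcases lt_trichotomy j k with h | h | h
      · simp [h, h.not_gt]
      · subst h
        have : M j j = 0 := by have := hM j j; omega
        simp [this]
      · simp [h, h.not_gt, hM j k]
    rw [clockWeight_add_single, clockWeight_add_single, smul_eq_mul, ← toCircle_intCast_eq_e, h]
    simp only [Circle.coe_mul]
    ring
  · simp

end ClockShift

/-! ### Rational noncommutative tori are quantum tori -/

section NCTorus

variable {n : ℕ} (N : ℕ) (B : (Fin n → ℤ) →ₗ[ℤ] (Fin n → ℤ) →ₗ[ℤ] ℤ)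

/-- The parameter matrix of the form `B / N`. -/
def formMatrix : Matrix (Fin n) (Fin n) ℝ :=
  fun j k => (B (Pi.single j 1) (Pi.single k 1) : ℝ) / N

variable {N B}

theorem form_neg {L : Type} [AddCommGroup L] {B : L →ₗ[ℤ] L →ₗ[ℤ] ℤ} (hB : ∀ x, B x x = 0)
    (x y : L) : B x y = -B y x := by
  have h := hB (x + y)
  simp only [map_add, LinearMap.add_apply, hB] at h
  omega

theorem exists_rep_NCTorus [NeZero N] (hB : ∀ x, B x x = 0) :
    Nonempty (NCTorus (formMatrix N B) →⋆ₐ[ℂ] (ClockSpace n N →L[ℂ] ClockSpace n N)) :=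
  ⟨NCTorus.lift (clockUnitary N fun j k => B (Pi.single j 1) (Pi.single k 1))
    (torusRel_clockUnitary N _ fun _ _ => form_neg hB _ _)⟩

/-- A universal algebra could collapse to zero; a unital representation on a nonzero space rules
this out. -/
theorem nontrivial_NCTorus [NeZero N] (hB : ∀ x, B x x = 0) :
    Nontrivial (NCTorus (formMatrix N B)) := by
  obtain ⟨π⟩ := exists_rep_NCTorus (N := N) hB
  refine ⟨1, 0, fun h => ?_⟩
  have := congrArg π h
  rw [map_one, map_zero] at this
  exact one_ne_zero this

/-- The exponent map of the free group. -/
def exponent (n : ℕ) : FreeGroup (Fin n) →* Multiplicative (Fin n → ℤ) :=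
  FreeGroup.lift fun j => Multiplicative.ofAdd (Pi.single j 1)

/-- The ordered monomial with given exponents. -/
def monomial (x : Fin n → ℤ) : FreeGroup (Fin n) := (List.ofFn fun j => FreeGroup.of j ^ x j).prod

theorem exponent_monomial (x : Fin n → ℤ) :
    exponent n (monomial x) = Multiplicative.ofAdd x := by
  rw [monomial, map_list_prod, List.map_ofFn, List.prod_ofFn]
  refine Multiplicative.toAdd.injective ?_
  rw [toAdd_prod]
  ext i
  simp [exponent, Pi.single_apply]

variable (θ : Matrix (Fin n) (Fin n) ℝ)

instance : (circleUnitary (NCTorus θ)).range.Normal where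
  conj_mem := by
    rintro _ ⟨c, rfl⟩ g
    refine ⟨c, ?_⟩
    rw [eq_mul_inv_iff_mul_eq]
    exact Subtype.ext (by simp)

/-- Modulo the central subgroup of scalar unitaries the generators commute, so the word map factors
through the exponent map to ℤⁿ. -/
theorem exists_word_eq_of_exponent_eq {g h : FreeGroup (Fin n)} (hgh : exponent n g = exponent n h) :
    ∃ c : Circle, (NCTorus.word θ g : NCTorus θ) = (c : ℂ) • (NCTorus.word θ h : NCTorus θ) := by
  let S := (circleUnitary (NCTorus θ)).range
  let q := (QuotientGroup.mk' S).comp (NCTorus.word θ)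
  have hcomm : ∀ j k, Commute (q (FreeGroup.of j)) (q (FreeGroup.of k)) := fun j k => by
    refine (QuotientGroup.eq (s := S)).mpr ?_
    change (_ * _)⁻¹ * (_ * _) ∈ S
    -- The torus relation says that (u_j u_k)⁻¹ u_k u_j is the scalar e(θ j k).
    refine ⟨Circle.exp (2 * Real.pi * θ j k), ?_⟩
    rw [eq_inv_mul_iff_mul_eq]
    refine Subtype.ext ?_
    have := NCTorus.torusRel θ j k
    simp only [NCTorus.u] at this
    simp [-Circle.coe_exp, coe_circleExp_two_pi, this]
  let H : Multiplicative (Fin n → ℤ) →* (unitary (NCTorus θ) ⧸ S) :=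
    (MonoidHom.noncommPiCoprod (fun j => zpowersHom _ (q (FreeGroup.of j)))
      (fun j k _ x y => by
        rw [zpowersHom_apply, zpowersHom_apply]
        exact ((hcomm j k).zpow_zpow _ _))).comp
      { toFun := fun x j => Multiplicative.ofAdd (x.toAdd j)
        map_one' := rfl
        map_mul' := fun _ _ => rfl }
  have hH : H.comp (exponent n) = q := by
    refine FreeGroup.ext_hom _ _ fun j => ?_
    have h1 : (fun i => Multiplicative.ofAdd ((Pi.single j 1 : Fin n → ℤ) i)) =
        Pi.mulSingle (M := fun _ : Fin n => Multiplicative ℤ) j (Multiplicative.ofAdd 1) := by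
      ext i
      by_cases h : i = j
      · subst h; simp
      · simp [h]
    have h2 := MonoidHom.noncommPiCoprod_mulSingle (fun j => zpowersHom _ (q (FreeGroup.of j)))
      (hcomm := fun j k _ x y => by
        rw [zpowersHom_apply, zpowersHom_apply]
        exact ((hcomm j k).zpow_zpow _ _)) j (Multiplicative.ofAdd 1)
    simp only [MonoidHom.comp_apply, exponent, FreeGroup.lift_apply_of, H]
    refine Eq.trans ?_ (h2.trans (by simp))
    exact congrArg _ h1
  have hq : q g = q h := by
    rw [← hH]
    exact congrArg H hgh
  obtain ⟨c, hc⟩ := (QuotientGroup.eq (s := S)).mp hq.symm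
  refine ⟨c, ?_⟩
  have := congrArg (fun a : unitary (NCTorus θ) => ((NCTorus.word θ h * a :) : NCTorus θ)) hc
  simpa using this.symm

/-- A ⋆-homomorphism acting on the generators by a character acts so on all words. -/
theorem map_word_of_map_gen {θ : Matrix (Fin n) (Fin n) ℝ}
    (α : NCTorus θ →⋆ₐ[ℂ] NCTorus θ) (χ : AddChar (Fin n → ℤ) Circle)
    (h : ∀ j, α (NCTorus.u θ j) = (χ (Pi.single j 1) : ℂ) • (NCTorus.u θ j : NCTorus θ))
    (g : FreeGroup (Fin n)) :
    α (NCTorus.word θ g) = (χ (exponent n g).toAdd : ℂ) • (NCTorus.word θ g : NCTorus θ) := by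
  let f₁ : FreeGroup (Fin n) →* NCTorus θ :=
    α.toAlgHom.toMonoidHom.comp ((unitary (NCTorus θ)).subtype.comp (NCTorus.word θ))
  let f₂ : FreeGroup (Fin n) →* NCTorus θ :=
    { toFun := fun g => (χ (exponent n g).toAdd : ℂ) • (NCTorus.word θ g : NCTorus θ)
      map_one' := by simp
      map_mul' := fun g h => by
        simp [AddChar.map_add_eq_mul, smul_smul, mul_comm] }
  have : f₁ = f₂ := FreeGroup.ext_hom _ _ fun j => (h j).trans (by
    simp [f₂, exponent, NCTorus.u])
  exact DFunLike.congr_fun this g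

/-- A rational noncommutative torus is a quantum torus over `ℤⁿ`. -/
def quantumTorusNCTorus (N : ℕ) [NeZero N] (B : (Fin n → ℤ) →ₗ[ℤ] (Fin n → ℤ) →ₗ[ℤ] ℤ)
    (hB : ∀ x, B x x = 0) : QuantumTorus N B (NCTorus (formMatrix N B)) where
  alt := hB
  nontrivial := nontrivial_NCTorus hB
  u x := NCTorus.word _ (monomial x)
  add x y := by
    obtain ⟨c, hc⟩ := exists_word_eq_of_exponent_eq (formMatrix N B)
      (g := monomial (x + y)) (h := monomial x * monomial y)
      (by rw [map_mul, exponent_monomial, exponent_monomial, exponent_monomial, ofAdd_add])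
    exact ⟨c, by rw [hc, map_mul]; rfl⟩
  comm := by
    set θ := formMatrix N B
    -- Conjugation by v scales each generator by a character value, hence scales monomials by the
    -- character; this extends a commutation relation from generators to monomials.
    have key (v : unitary (NCTorus θ)) (χ : AddChar (Fin n → ℤ) Circle)
        (h : ∀ j, (v : NCTorus θ) * NCTorus.u θ j =
          (χ (Pi.single j 1) : ℂ) • ((NCTorus.u θ j : NCTorus θ) * v)) (x : Fin n → ℤ) :
        (v : NCTorus θ) * NCTorus.word θ (monomial x) =
          (χ x : ℂ) • ((NCTorus.word θ (monomial x) : NCTorus θ) * v) := by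
      have h1 := map_word_of_map_gen (Unitary.conjStarAlgAut ℂ (NCTorus θ) v).toStarAlgHom χ
        (fun j => by
          change Unitary.conjStarAlgAut ℂ (NCTorus θ) v (NCTorus.u θ j) = _
          rw [Unitary.conjStarAlgAut_apply, h, smul_mul_assoc, mul_assoc,
            Unitary.mul_star_self_of_mem v.2, mul_one]) (monomial x)
      change Unitary.conjStarAlgAut ℂ (NCTorus θ) v _ = _ at h1
      rw [Unitary.conjStarAlgAut_apply, exponent_monomial] at h1
      have h2 := congrArg (fun a => a * (v : NCTorus θ)) h1
      simpa [mul_assoc] using h2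
    have h1 (k : Fin n) (x : Fin n → ℤ) :
        (NCTorus.u θ k : NCTorus θ) * NCTorus.word θ (monomial x) =
          e ((B x (Pi.single k 1) : ℝ) / N) •
            ((NCTorus.word θ (monomial x) : NCTorus θ) * NCTorus.u θ k) := by
      have := key (NCTorus.u θ k) (phase N (B.flip (Pi.single k 1)).toAddMonoidHom)
        (fun j => by rw [coe_phase]; exact NCTorus.torusRel θ j k) x
      rwa [coe_phase] at this
    intro x y
    -- The relation is extended once in each argument: `h1` handles x against a generator, and `key`
    -- for the adjoint of the monomial of x, with the character e(B(x,·)/N), handles y.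
    have h2 := key (star (NCTorus.word θ (monomial x))) (phase N (B x).toAddMonoidHom)
      (fun k => by
        rw [coe_phase]
        exact (mul_unitary_eq_smul_iff _ _ _).mp (h1 k x)) y
    rw [coe_phase] at h2
    exact (mul_unitary_eq_smul_iff _ _ _).mpr h2
  gauge χ := by
    set θ := formMatrix N B
    -- Both sides of each relation are bilinear in the generators, so rescaled generators satisfy it
    -- too and the universal property yields the gauge automorphism.
    have hv : TorusRel θ fun j => circleUnitary _ (χ (Pi.single j 1)) * NCTorus.u θ j :=
      fun j k => by
        rw [coe_circleUnitary_mul, coe_circleUnitary_mul]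
        simp only [smul_mul_assoc, mul_smul_comm, NCTorus.torusRel θ j k]
        rw [smul_comm (χ (Pi.single k 1) : ℂ) (χ (Pi.single j 1) : ℂ), smul_comm _ (e _),
          smul_comm _ (e _)]
    refine ⟨NCTorus.lift _ hv, fun x => ?_⟩
    have := map_word_of_map_gen (NCTorus.lift _ hv) χ
      (fun j => (NCTorus.lift_u _ hv j).trans (coe_circleUnitary_mul _ _)) (monomial x)
    rw [exponent_monomial] at this
    exact this
  dense a := by
    refine closure_mono (Submodule.span_le.mpr ?_) (NCTorus.mem_closure_span_word a)
    rintro _ ⟨g, rfl⟩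
    obtain ⟨c, hc⟩ := exists_word_eq_of_exponent_eq (formMatrix N B)
      (g := g) (h := monomial (exponent n g).toAdd) (by rw [exponent_monomial, ofAdd_toAdd])
    change (NCTorus.word (formMatrix N B) g : NCTorus (formMatrix N B)) ∈ _
    rw [hc]
    exact Submodule.smul_mem _ _ (Submodule.subset_span ⟨_, rfl⟩)

end NCTorus

/-! ### Uniqueness of quantum tori -/

namespace QuantumTorus

variable {N : ℕ} {L : Type} [AddCommGroup L] {B : L →ₗ[ℤ] L →ₗ[ℤ] ℤ} {A : Type} [CStarAlgebra A]

theorem exists_mul_eq (Q : QuantumTorus N B A) (x y : L) :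
    ∃ c : Circle, (Q.u x : A) * Q.u y = (c : ℂ) • (Q.u (x + y) : A) := by
  obtain ⟨c, hc⟩ := Q.add x y
  refine ⟨c⁻¹, ?_⟩
  rw [hc, smul_smul, ← Circle.coe_mul, inv_mul_cancel, Circle.coe_one, one_smul]

theorem exists_star_eq (Q : QuantumTorus N B A) (x : L) :
    ∃ c : Circle, star (Q.u x : A) = (c : ℂ) • (Q.u (-x) : A) := by
  obtain ⟨c, hc⟩ := Q.exists_one_eq
  obtain ⟨d, hd⟩ := Q.add (-x) x
  refine ⟨c * d, ?_⟩
  rw [neg_add_cancel] at hd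
  rw [hd, smul_smul, ← Circle.coe_mul] at hc
  calc star (Q.u x : A) = 1 * star (Q.u x : A) := (one_mul _).symm
    _ = _ := by
      rw [hc, smul_mul_assoc, mul_assoc, Unitary.mul_star_self_of_mem (Q.u x).2, mul_one]

/-- Change of lattice. -/
def congr (Q : QuantumTorus N B A) {L' : Type} [AddCommGroup L'] (f : L' ≃ₗ[ℤ] L)
    (B' : L' →ₗ[ℤ] L' →ₗ[ℤ] ℤ) (hB' : ∀ x y, B' x y = B (f x) (f y)) : QuantumTorus N B' A where
  alt x := by rw [hB', Q.alt]
  nontrivial := Q.nontrivial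
  u x := Q.u (f x)
  add x y := by rw [map_add]; exact Q.add _ _
  comm x y := by rw [hB']; exact Q.comm _ _
  gauge χ := by
    obtain ⟨α, hα⟩ := Q.gauge (χ.compAddMonoidHom f.symm.toLinearMap.toAddMonoidHom)
    refine ⟨α, fun x => (hα (f x)).trans ?_⟩
    simp [AddChar.compAddMonoidHom_apply]
  dense a := by
    have h : Set.range (fun x => (Q.u (f x) : A)) = Set.range fun x => (Q.u x : A) :=
      f.surjective.range_comp fun x => (Q.u x : A)
    rw [h]
    exact Q.dense a

/-- Induction on the word: products and inverses of the u x are again of this form up to phases,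
which need not be tracked. -/
theorem exists_lift_eq {n : ℕ} {B : (Fin n → ℤ) →ₗ[ℤ] (Fin n → ℤ) →ₗ[ℤ] ℤ}
    (Q : QuantumTorus N B A) (g : FreeGroup (Fin n)) :
    ∃ c : Circle, (FreeGroup.lift (fun j => Q.u (Pi.single j 1)) g : A) =
      (c : ℂ) • (Q.u (exponent n g).toAdd : A) := by
  induction g using FreeGroup.induction_on with
  | C1 =>
    obtain ⟨c, hc⟩ := Q.exists_one_eq
    exact ⟨c, by simpa using hc⟩
  | of j => exact ⟨1, by simp [exponent]⟩
  | inv_of j _ =>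
    obtain ⟨c, hc⟩ := Q.exists_star_eq (Pi.single j 1)
    refine ⟨c, ?_⟩
    rw [map_inv, FreeGroup.lift_apply_of, ← Unitary.star_eq_inv, Unitary.coe_star, hc, map_inv,
      exponent, FreeGroup.lift_apply_of]
    rfl
  | mul g h hg hh =>
    obtain ⟨c, hc⟩ := hg
    obtain ⟨d, hd⟩ := hh
    obtain ⟨k, hk⟩ := Q.exists_mul_eq (exponent n g).toAdd (exponent n h).toAdd
    refine ⟨c * d * k, ?_⟩
    rw [map_mul, Submonoid.coe_mul, hc, hd, smul_mul_smul_comm, hk, smul_smul, ← Circle.coe_mul,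
      ← Circle.coe_mul, map_mul, toAdd_mul]

/-- A quantum torus over `ℤⁿ` is a noncommutative torus. -/
theorem nonempty_equiv_NCTorus [NeZero N] {n : ℕ} {B : (Fin n → ℤ) →ₗ[ℤ] (Fin n → ℤ) →ₗ[ℤ] ℤ}
    (Q : QuantumTorus N B A) : Nonempty (NCTorus (formMatrix N B) ≃⋆ₐ[ℂ] A) := by
  have hv : TorusRel (formMatrix N B) fun j => Q.u (Pi.single j 1) := fun j k => Q.comm _ _
  let Φ := NCTorus.lift _ hv
  let P := quantumTorusNCTorus N B Q.alt
  have hΦ : ∀ x, ∃ c : Circle, Φ (P.u x) = (c : ℂ) • (Q.u x : A) := fun x => by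
    obtain ⟨c, hc⟩ := Q.exists_lift_eq (monomial x)
    rw [exponent_monomial] at hc
    exact ⟨c, (NCTorus.lift_word _ hv _).trans hc⟩
  have hinj : Function.Injective Φ :=
    injective_of_map_u P Q Φ fun x => (hΦ x).imp' (fun c : Circle => (c : ℂ)) fun _ h => h
  refine ⟨StarAlgEquiv.ofBijective Φ ⟨hinj, fun a => ?_⟩⟩
  -- An injective ⋆-homomorphism of C⋆-algebras is isometric, so its range is complete; as it
  -- contains every Q.u x, it is everything.
  have hclosed : IsClosed (Set.range Φ) :=
    (NonUnitalStarAlgHom.isometry Φ hinj).isClosedEmbedding.isClosed_range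
  refine closure_minimal (s := (Submodule.span ℂ (Set.range fun x => (Q.u x : A)) : Set A))
    ?_ hclosed (Q.dense a)
  refine (Submodule.span_le (p := LinearMap.range Φ.toAlgHom.toLinearMap)).mpr ?_
  rintro _ ⟨x, rfl⟩
  obtain ⟨c, hc⟩ := hΦ x
  refine ⟨(c : ℂ)⁻¹ • (P.u x : NCTorus _), (map_smul Φ _ _).trans ?_⟩
  rw [hc, inv_smul_smul₀ (Circle.coe_ne_zero c)]

/-- The rank n and the form B' come from a basis of L and are chosen before A, so two quantum tori
for the same B are compared with the same noncommutative torus. -/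
theorem exists_equiv_NCTorus [NeZero N] [Module.Free ℤ L] [Module.Finite ℤ L]
    (B : L →ₗ[ℤ] L →ₗ[ℤ] ℤ) :
    ∃ (n : ℕ) (B' : (Fin n → ℤ) →ₗ[ℤ] (Fin n → ℤ) →ₗ[ℤ] ℤ),
      ∀ (A : Type) [CStarAlgebra A], QuantumTorus N B A → (∀ x, B' x x = 0) ∧
        Nonempty (NCTorus (formMatrix N B') ≃⋆ₐ[ℂ] A) := by
  let f := (Module.finBasis ℤ L).equivFun
  let B' := B.compl₁₂ f.symm.toLinearMap f.symm.toLinearMap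
  refine ⟨_, B', fun A _ Q => ⟨fun x => Q.alt _, ?_⟩⟩
  exact (Q.congr f.symm B' fun _ _ => rfl).nonempty_equiv_NCTorus

/-- Two quantum tori with the same parameters are isomorphic. -/
theorem nonempty_equiv [NeZero N] [Module.Free ℤ L] [Module.Finite ℤ L] {A' : Type}
    [CStarAlgebra A'] (P : QuantumTorus N B A) (Q : QuantumTorus N B A') :
    Nonempty (A ≃⋆ₐ[ℂ] A') := by
  obtain ⟨n, B', h⟩ := exists_equiv_NCTorus (N := N) B
  obtain ⟨-, ⟨f⟩⟩ := h A P
  obtain ⟨-, ⟨g⟩⟩ := h A' Q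
  exact ⟨f.symm.trans g⟩

/-- A quantum torus has a nonzero finite-dimensional representation. -/
theorem exists_rep [NeZero N] [Module.Free ℤ L] [Module.Finite ℤ L] (Q : QuantumTorus N B A) :
    ∃ n : ℕ, Nonempty (A →⋆ₐ[ℂ] (ClockSpace n N →L[ℂ] ClockSpace n N)) := by
  obtain ⟨n, B', h⟩ := exists_equiv_NCTorus (N := N) B
  obtain ⟨hB', ⟨f⟩⟩ := h A Q
  obtain ⟨π⟩ := exists_rep_NCTorus (N := N) hB'
  exact ⟨n, ⟨π.comp f.symm.toStarAlgHom⟩⟩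

end QuantumTorus

/-! ### Tensor products of quantum tori -/

section Tensor

variable {A A' : Type} [CStarAlgebra A] [CStarAlgebra A']

/-- The operator (π ⊗ ρ)(1) fixes a nonzero vector x ⊗ y, so 1 has nonzero spatial seminorm and
survives in the completion. -/
theorem nontrivial_CStarTensor {H K : Type} [NormedAddCommGroup H] [InnerProductSpace ℂ H]
    [CompleteSpace H] [NormedAddCommGroup K] [InnerProductSpace ℂ K] [CompleteSpace K]
    [Nontrivial H] [Nontrivial K]
    (π : A →⋆ₐ[ℂ] (H →L[ℂ] H)) (ρ : A' →⋆ₐ[ℂ] (K →L[ℂ] K)) : Nontrivial (CStarTensor A A') := by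
  refine ⟨1, 0, fun h => ?_⟩
  have h1 : spatialSeminorm A A' 1 = 0 := by
    rw [← CStarSeminorm.norm_incl, CStarSeminorm.incl_one, h, norm_zero]
  have h2 : ‖repTensor π ρ 1‖ ≤ 0 := h1 ▸ CStarSeminorm.le_sup (p := repSeminorm π ρ)
    spatial_nonempty spatial_bdd
    ⟨H, _, _, _, K, _, _, _, π, ρ, rfl⟩ 1
  obtain ⟨x, hx⟩ := exists_ne (0 : H)
  obtain ⟨y, hy⟩ := exists_ne (0 : K)
  have h3 : repTensor π ρ 1 (x ⊗ₜ y) = x ⊗ₜ y := by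
    rw [Algebra.TensorProduct.one_def, repTensor_tmul, map_one, map_one]
    simp
  have h4 := (repTensor π ρ 1).le_opNorm (x ⊗ₜ y)
  rw [h3, TensorProduct.norm_tmul] at h4
  have h5 : 0 < ‖x‖ * ‖y‖ := mul_pos (norm_pos_iff.mpr hx) (norm_pos_iff.mpr hy)
  nlinarith

/-- Precomposing π ⊗ ρ with α ⊗ β gives another member of the family defining the spatial norm.
Hence α ⊗ β is contractive and extends to the completion. -/
theorem repTensor_map {H K : Type} [NormedAddCommGroup H] [InnerProductSpace ℂ H]
    [CompleteSpace H] [NormedAddCommGroup K] [InnerProductSpace ℂ K] [CompleteSpace K]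
    (π : A →⋆ₐ[ℂ] (H →L[ℂ] H)) (ρ : A' →⋆ₐ[ℂ] (K →L[ℂ] K)) (α : A →⋆ₐ[ℂ] A) (β : A' →⋆ₐ[ℂ] A')
    (x : A ⊗[ℂ] A') :
    repTensor π ρ (Algebra.TensorProduct.map α.toAlgHom β.toAlgHom x) =
      repTensor (π.comp α) (ρ.comp β) x := by
  induction x using TensorProduct.induction_on with
  | zero => simp
  | add x y hx hy => simp only [map_add, hx, hy]
  | tmul a b =>
    rw [Algebra.TensorProduct.map_tmul, repTensor_tmul, repTensor_tmul]
    rfl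

/-- The tensor product of two endomorphisms, on the algebraic tensor product. -/
def tensorMapAlg (α : A →⋆ₐ[ℂ] A) (β : A' →⋆ₐ[ℂ] A') : A ⊗[ℂ] A' →⋆ₐ[ℂ] A ⊗[ℂ] A' :=
  { Algebra.TensorProduct.map α.toAlgHom β.toAlgHom with
    map_star' := fun x => by
      change Algebra.TensorProduct.map α.toAlgHom β.toAlgHom (star x) =
        star (Algebra.TensorProduct.map α.toAlgHom β.toAlgHom x)
      induction x using TensorProduct.induction_on with
      | zero => simp
      | add x y hx hy => simp only [star_add, map_add, hx, hy]
      | tmul a b => simp [map_star] }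

/-- The tensor product of two endomorphisms. -/
def tensorMap (α : A →⋆ₐ[ℂ] A) (β : A' →⋆ₐ[ℂ] A') : CStarTensor A A' →⋆ₐ[ℂ] CStarTensor A A' :=
  (spatialSeminorm A A').lift ((spatialSeminorm A A').inclHom.comp (tensorMapAlg α β)) fun x => by
    refine ((spatialSeminorm A A').norm_incl _).trans_le (CStarSeminorm.sup_le _ _ ?_)
    rintro _ ⟨H, _, _, _, K, _, _, _, π, ρ, rfl⟩
    refine le_of_eq_of_le (congrArg norm (repTensor_map π ρ α β x)) ?_
    exact CStarSeminorm.le_sup (p := repSeminorm (π.comp α) (ρ.comp β))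
      spatial_nonempty spatial_bdd
      ⟨H, _, _, _, K, _, _, _, _, _, rfl⟩ x

/-- The elementary tensor `a ⊗ b`. -/
def tmul (a : A) (b : A') : CStarTensor A A' := (spatialSeminorm A A').inclHom (a ⊗ₜ b)

theorem tensorMap_tmul (α : A →⋆ₐ[ℂ] A) (β : A' →⋆ₐ[ℂ] A') (a : A) (b : A') :
    tensorMap α β (tmul a b) = tmul (α a) (β b) :=
  CStarSeminorm.lift_incl _ _ _ _

theorem tmul_mul_tmul (a a' : A) (b b' : A') :
    tmul a b * tmul a' b' = tmul (a * a') (b * b') := by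
  simp only [tmul, ← map_mul, Algebra.TensorProduct.tmul_mul_tmul]

theorem star_tmul (a : A) (b : A') : star (tmul a b) = tmul (star a) (star b) := by
  simp only [tmul, ← map_star, TensorProduct.star_tmul]

theorem tmul_one_one : tmul (1 : A) (1 : A') = 1 := map_one _

theorem smul_tmul_smul (c d : ℂ) (a : A) (b : A') :
    tmul (c • a) (d • b) = (c * d) • tmul a b := by
  simp only [tmul, ← map_smul, TensorProduct.smul_tmul_smul]

theorem norm_tmul_le (a : A) (b : A') : ‖tmul a b‖ ≤ ‖a‖ * ‖b‖ := by
  refine ((spatialSeminorm A A').norm_incl _).trans_le (CStarSeminorm.sup_le _ _ ?_)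
  rintro _ ⟨H, _, _, _, K, _, _, _, π, ρ, rfl⟩
  change ‖TensorProduct.mapL (π a) (ρ b)‖ ≤ _
  exact (TensorProduct.norm_mapL_le _ _).trans (mul_le_mul
    (NonUnitalStarAlgHom.norm_apply_le π a) (NonUnitalStarAlgHom.norm_apply_le ρ b)
    (norm_nonneg _) (norm_nonneg _))

variable (A A') in
/-- The elementary tensor as a continuous bilinear map. -/
def tmulL : A →L[ℂ] A' →L[ℂ] CStarTensor A A' :=
  LinearMap.mkContinuous₂ (LinearMap.mk₂ ℂ tmul
    (fun a a' b => by simp only [tmul, TensorProduct.add_tmul, map_add])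
    (fun c a b => by simpa using smul_tmul_smul c 1 a b)
    (fun a b b' => by simp only [tmul, TensorProduct.tmul_add, map_add])
    (fun c a b => by simpa using smul_tmul_smul 1 c a b)) 1
    fun a b => by rw [one_mul]; exact norm_tmul_le a b

theorem tmul_mem_unitary (a : unitary A) (b : unitary A') :
    tmul (a : A) (b : A') ∈ unitary (CStarTensor A A') := by
  rw [Unitary.mem_iff, star_tmul, tmul_mul_tmul, tmul_mul_tmul]
  simp [tmul_one_one]

/-- The elementary tensor is continuous in each variable separately, so density is transported one
factor at a time. -/
theorem mem_closure_span_tmul {S : Set A} {S' : Set A'}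
    (hS : ∀ a, a ∈ closure (Submodule.span ℂ S : Set A))
    (hS' : ∀ a, a ∈ closure (Submodule.span ℂ S' : Set A')) {T : Set (CStarTensor A A')}
    (hT : ∀ a ∈ S, ∀ b ∈ S', tmul a b ∈ T) (x : CStarTensor A A') :
    x ∈ closure (Submodule.span ℂ T : Set (CStarTensor A A')) := by
  let M := (Submodule.span ℂ T).topologicalClosure
  have h1 : ∀ a, ∀ b ∈ S', tmul a b ∈ M := fun a b hb => by
    refine closure_span_induction (p := fun a => (tmulL A A').flip b a ∈ M) hS ?_ ?_ ?_ ?_ ?_ a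
    · exact (Submodule.isClosed_topologicalClosure _).preimage ((tmulL A A').flip b).continuous
    · exact fun a ha => subset_closure (Submodule.subset_span (hT a ha b hb))
    · rw [map_zero]; exact M.zero_mem
    · intro a a' h h'; rw [map_add]; exact M.add_mem h h'
    · intro c a h; rw [map_smul]; exact M.smul_mem c h
  have h2 : ∀ a b, tmul a b ∈ M := fun a b => by
    refine closure_span_induction (p := fun b => tmulL A A' a b ∈ M) hS' ?_ ?_ ?_ ?_ ?_ b
    · exact (Submodule.isClosed_topologicalClosure _).preimage (tmulL A A' a).continuous
    · exact fun b hb => h1 a b hb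
    · rw [map_zero]; exact M.zero_mem
    · intro b b' h h'; rw [map_add]; exact M.add_mem h h'
    · intro c b h; rw [map_smul]; exact M.smul_mem c h
  refine CStarSeminorm.ind _ isClosed_closure (fun y => ?_) x
  change (spatialSeminorm A A').inclHom y ∈ M
  induction y using TensorProduct.induction_on with
  | zero => rw [map_zero]; exact M.zero_mem
  | add y z hy hz => rw [map_add]; exact M.add_mem hy hz
  | tmul a b => exact h2 a b

variable {L L' : Type} [AddCommGroup L] [AddCommGroup L']

/-- The orthogonal sum of two bilinear forms. -/
def sumForm (B : L →ₗ[ℤ] L →ₗ[ℤ] ℤ) (B' : L' →ₗ[ℤ] L' →ₗ[ℤ] ℤ) :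
    (L × L') →ₗ[ℤ] (L × L') →ₗ[ℤ] ℤ :=
  B.compl₁₂ (LinearMap.fst ℤ L L') (LinearMap.fst ℤ L L') +
    B'.compl₁₂ (LinearMap.snd ℤ L L') (LinearMap.snd ℤ L L')

theorem sumForm_apply (B : L →ₗ[ℤ] L →ₗ[ℤ] ℤ) (B' : L' →ₗ[ℤ] L' →ₗ[ℤ] ℤ) (x y : L × L') :
    sumForm B B' x y = B x.1 y.1 + B' x.2 y.2 := rfl

theorem e_add (x y : ℝ) : e (x + y) = e x * e y := by
  rw [e, e, e, ← Complex.exp_add]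
  congr 1
  push_cast
  ring

/-- The tensor product of quantum tori. -/
def QuantumTorus.tensor {N : ℕ} [NeZero N] [Module.Free ℤ L] [Module.Finite ℤ L]
    [Module.Free ℤ L'] [Module.Finite ℤ L'] {B : L →ₗ[ℤ] L →ₗ[ℤ] ℤ} {B' : L' →ₗ[ℤ] L' →ₗ[ℤ] ℤ}
    (P : QuantumTorus N B A) (Q : QuantumTorus N B' A') :
    QuantumTorus N (sumForm B B') (CStarTensor A A') where
  alt x := by rw [sumForm_apply, P.alt, Q.alt, add_zero]
  nontrivial := by
    obtain ⟨n, ⟨π⟩⟩ := P.exists_rep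
    obtain ⟨m, ⟨ρ⟩⟩ := Q.exists_rep
    exact nontrivial_CStarTensor π ρ
  u x := ⟨tmul (P.u x.1) (Q.u x.2), tmul_mem_unitary _ _⟩
  add x y := by
    obtain ⟨c, hc⟩ := P.add x.1 y.1
    obtain ⟨d, hd⟩ := Q.add x.2 y.2
    refine ⟨c * d, ?_⟩
    simp only [Prod.fst_add, Prod.snd_add, hc, hd, smul_tmul_smul, tmul_mul_tmul, Circle.coe_mul]
  comm x y := by
    simp only [tmul_mul_tmul, P.comm x.1 y.1, Q.comm x.2 y.2, smul_tmul_smul, sumForm_apply]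
    rw [← e_add]
    push_cast
    rw [add_div]
  gauge χ := by
    obtain ⟨α, hα⟩ := P.gauge (χ.compAddMonoidHom (AddMonoidHom.inl L L'))
    obtain ⟨β, hβ⟩ := Q.gauge (χ.compAddMonoidHom (AddMonoidHom.inr L L'))
    refine ⟨tensorMap α β, fun x => ?_⟩
    rw [tensorMap_tmul, hα, hβ, smul_tmul_smul, ← Circle.coe_mul]
    simp [AddChar.compAddMonoidHom_apply, ← AddChar.map_add_eq_mul]
  dense := mem_closure_span_tmul P.dense Q.dense (by
    rintro _ ⟨x, rfl⟩ _ ⟨y, rfl⟩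
    exact ⟨(x, y), rfl⟩)

end Tensor

/-! ### Commutative tori -/

section Commutative

/-- The trigonometric monomial with given exponents. -/
def trigMonomial {k : ℕ} (x : Fin k → ℤ) : C(Fin k → Circle, ℂ) where
  toFun z := torusChar z x
  continuous_toFun := continuous_subtype_val.comp (continuous_torusChar x)

theorem trigMonomial_add {k : ℕ} (x y : Fin k → ℤ) :
    trigMonomial (x + y) = trigMonomial x * trigMonomial y := by
  ext z
  simp [trigMonomial, AddChar.map_add_eq_mul]

theorem trigMonomial_zero {k : ℕ} : trigMonomial (0 : Fin k → ℤ) = 1 := by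
  ext z
  simp [trigMonomial]

theorem star_trigMonomial {k : ℕ} (x : Fin k → ℤ) :
    star (trigMonomial x) = trigMonomial (-x) := by
  ext z
  simp only [trigMonomial, ContinuousMap.star_apply, ContinuousMap.coe_mk,
    AddChar.map_neg_eq_inv, Circle.coe_inv_eq_conj]
  rfl

/-- The trigonometric polynomials. -/
def trigSubalgebra (k : ℕ) : StarSubalgebra ℂ C(Fin k → Circle, ℂ) where
  toSubalgebra := (Submodule.span ℂ (Set.range trigMonomial)).toSubalgebra
    (Submodule.subset_span ⟨0, trigMonomial_zero⟩) fun a b ha hb => by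
      induction ha, hb using Submodule.span_induction₂ with
      | mem_mem a b ha hb =>
        obtain ⟨x, rfl⟩ := ha
        obtain ⟨y, rfl⟩ := hb
        exact Submodule.subset_span ⟨x + y, trigMonomial_add x y⟩
      | zero_left b _ => rw [zero_mul]; exact Submodule.zero_mem _
      | zero_right a _ => rw [mul_zero]; exact Submodule.zero_mem _
      | add_left a a' b _ _ _ h h' => rw [add_mul]; exact Submodule.add_mem _ h h'
      | add_right a b b' _ _ _ h h' => rw [mul_add]; exact Submodule.add_mem _ h h'
      | smul_left c a b _ _ h => rw [smul_mul_assoc]; exact Submodule.smul_mem _ c h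
      | smul_right c a b _ _ h => rw [mul_smul_comm]; exact Submodule.smul_mem _ c h
  star_mem' {a} ha := by
    change star a ∈ Submodule.span ℂ (Set.range trigMonomial)
    change a ∈ Submodule.span ℂ (Set.range trigMonomial) at ha
    induction ha using Submodule.span_induction with
    | mem a ha =>
      obtain ⟨x, rfl⟩ := ha
      rw [star_trigMonomial]
      exact Submodule.subset_span ⟨-x, rfl⟩
    | zero => rw [star_zero]; exact Submodule.zero_mem _
    | add a b _ _ ha hb => rw [star_add]; exact Submodule.add_mem _ ha hb
    | smul c a _ ha => rw [star_smul]; exact Submodule.smul_mem _ _ ha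

/-- Stone–Weierstrass: the coordinate functions are monomials and separate points. -/
theorem mem_closure_span_trigMonomial {k : ℕ} (f : C(Fin k → Circle, ℂ)) :
    f ∈ closure (Submodule.span ℂ (Set.range (trigMonomial (k := k))) : Set C(Fin k → Circle, ℂ)) := by
  have h : (trigSubalgebra k).topologicalClosure = ⊤ := by
    refine ContinuousMap.starSubalgebra_topologicalClosure_eq_top_of_separatesPoints _ ?_
    intro z w hzw
    obtain ⟨j, hj⟩ := Function.ne_iff.mp hzw
    refine ⟨_, ⟨trigMonomial (Pi.single j 1), Submodule.subset_span ⟨_, rfl⟩, rfl⟩, ?_⟩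
    exact fun h => hj (Circle.ext (by simpa [trigMonomial] using h))
  have hf : f ∈ (trigSubalgebra k).topologicalClosure := h ▸ StarSubalgebra.mem_top
  exact hf

/-- A character of ℤᵏ is determined by its values on the standard basis; hence the gauge action on
C(𝕋ᵏ) is by translations. -/
theorem addChar_eq_torusChar {k : ℕ} (χ : AddChar (Fin k → ℤ) Circle) (x : Fin k → ℤ) :
    torusChar (fun j => χ (Pi.single j 1)) x = χ x := by
  have hx : x = ∑ j, x j • (Pi.single j 1 : Fin k → ℤ) := by
    ext i
    simp [Finset.sum_apply, Pi.single_apply]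
  conv_rhs => rw [hx]
  rw [torusChar_apply]
  have h := map_prod χ.toMonoidHom (fun j => Multiplicative.ofAdd (x j • (Pi.single j 1 : Fin k → ℤ)))
    Finset.univ
  rw [← ofAdd_sum] at h
  refine Eq.trans ?_ h.symm
  exact Finset.prod_congr rfl fun j _ => (AddChar.map_zsmul_eq_zpow χ (x j) _).symm

/-- The algebra of continuous functions on the torus is a quantum torus for the zero form. -/
def quantumTorusCircle (N k : ℕ) :
    QuantumTorus N (0 : (Fin k → ℤ) →ₗ[ℤ] (Fin k → ℤ) →ₗ[ℤ] ℤ) C(Fin k → Circle, ℂ) where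
  alt _ := rfl
  nontrivial := inferInstance
  u x := ⟨trigMonomial x, by
    rw [Unitary.mem_iff, star_trigMonomial, ← trigMonomial_add, ← trigMonomial_add]
    simp [trigMonomial_zero]⟩
  add x y := ⟨1, by simp [trigMonomial_add]⟩
  comm x y := by
    rw [mul_comm]
    simp [e]
  gauge χ := by
    refine ⟨ContinuousMap.compStarAlgHom' ℂ ℂ
      ⟨fun z => (fun j => χ (Pi.single j 1)) * z, continuous_const.mul continuous_id⟩, fun x => ?_⟩
    ext z
    simp [trigMonomial, torusChar_mul, addChar_eq_torusChar]
  dense := mem_closure_span_trigMonomial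

/-- The complex numbers are the quantum torus over the zero lattice. -/
def quantumTorusComplex (N : ℕ) :
    QuantumTorus N (0 : PUnit.{1} →ₗ[ℤ] PUnit.{1} →ₗ[ℤ] ℤ) ℂ where
  alt _ := rfl
  nontrivial := inferInstance
  u _ := 1
  add _ _ := ⟨1, by simp⟩
  comm _ _ := by simp [e]
  gauge χ := ⟨StarAlgHom.id ℂ ℂ, fun x => by
    rw [Subsingleton.elim x 0, AddChar.map_zero_eq_one, Circle.coe_one, one_smul]
    rfl⟩
  dense a := subset_closure (by
    have : a = a • (((1 : unitary ℂ) : ℂ)) := by simp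
    rw [this]
    exact Submodule.smul_mem _ _ (Submodule.subset_span ⟨PUnit.unit, rfl⟩))

end Commutative

/-! ### The hyperbolic plane -/

/-- The alternating form of determinant `d²` on `ℤ²`. -/
def planeForm (d : ℤ) : (Fin 2 → ℤ) →ₗ[ℤ] (Fin 2 → ℤ) →ₗ[ℤ] ℤ :=
  Matrix.toLinearMap₂' ℤ !![0, d; -d, 0]

theorem planeForm_apply (d : ℤ) (x y : Fin 2 → ℤ) :
    planeForm d x y = d * (x 0 * y 1 - x 1 * y 0) := by
  simp [planeForm, Matrix.toLinearMap₂'_apply, Fin.sum_univ_two]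
  ring

theorem formMatrix_planeForm (N : ℕ) (d : ℤ) :
    formMatrix N (planeForm d) = skew2 (((d / N : ℚ) : ℝ)) := by
  ext i j
  fin_cases i <;> fin_cases j <;> simp [formMatrix, planeForm_apply, skew2, neg_div]

/-- The two-dimensional noncommutative torus is a quantum torus. -/
def quantumTorusPlane (N : ℕ) [NeZero N] (d : ℤ) :
    QuantumTorus N (planeForm d) (NCTorus (skew2 ((d / N : ℚ) : ℝ))) :=
  formMatrix_planeForm N d ▸ quantumTorusNCTorus N (planeForm d) fun x => by
    rw [planeForm_apply, mul_comm (x 0), sub_self, mul_zero]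

/-! ### The normal form of alternating forms over the integers -/

section NormalForm

variable {L : Type} [AddCommGroup L]

/-- A nonzero alternating form over the integers splits off a plane. -/
theorem exists_split_plane (B : L →ₗ[ℤ] L →ₗ[ℤ] ℤ) (hB : ∀ x, B x x = 0) (h : B ≠ 0) :
    ∃ (d : ℤ) (K : Submodule ℤ L) (f : L ≃ₗ[ℤ] (Fin 2 → ℤ) × K),
      ∀ x y, B x y = planeForm d (f x).1 (f y).1 + B (f x).2 (f y).2 := by
  classical
  -- The least positive value d of B will be the scale of the plane; a negative value becomes
  -- positive on replacing x by -x.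
  have hex : ∃ m : ℕ, 0 < m ∧ ∃ x y, B x y = m := by
    by_contra! hcon
    refine h (LinearMap.ext₂ fun x y => ?_)
    have h1 := hcon (B x y).natAbs
    by_contra hne
    have hpos : 0 < (B x y).natAbs := Int.natAbs_pos.mpr hne
    rcases Int.natAbs_eq (B x y) with h2 | h2
    · exact h1 hpos x y h2
    · refine h1 hpos (-x) y ?_
      rw [map_neg, LinearMap.neg_apply]
      omega
  obtain ⟨hd, x, y, hxy⟩ := Nat.find_spec hex
  set d := Nat.find hex
  have hmin : ∀ m : ℤ, 0 ≤ m → m < d → (∃ a b, B a b = m) → m = 0 := fun m h0 hm hab => by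
    by_contra hne
    refine Nat.find_min hex (m := m.toNat) (by omega) ⟨by omega, ?_⟩
    obtain ⟨a, b, hab⟩ := hab
    exact ⟨a, b, by omega⟩
  have hd' : (d : ℤ) ≠ 0 := by omega
  -- Subtracting a multiple of y from z turns B x z into its remainder modulo d, which minimality of
  -- d forces to be 0; similarly in the other argument.
  have hx : ∀ z, (d : ℤ) ∣ B x z := fun z => by
    refine Int.dvd_of_emod_eq_zero (hmin _ (Int.emod_nonneg _ hd') (Int.emod_lt_of_pos _ (by omega))
      ⟨x, z - (B x z / d) • y, ?_⟩)
    rw [map_sub, map_smul, hxy, smul_eq_mul, Int.emod_def, mul_comm]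
  have hy : ∀ z, (d : ℤ) ∣ B z y := fun z => by
    refine Int.dvd_of_emod_eq_zero (hmin _ (Int.emod_nonneg _ hd') (Int.emod_lt_of_pos _ (by omega))
      ⟨z - (B z y / d) • x, y, ?_⟩)
    rw [map_sub, map_smul, LinearMap.sub_apply, LinearMap.smul_apply, hxy, smul_eq_mul,
      Int.emod_def, mul_comm]
  let a : L →ₗ[ℤ] ℤ :=
    { toFun := fun z => B z y / d
      map_add' := fun z w => by
        rw [map_add, LinearMap.add_apply, Int.add_ediv_of_dvd_left (hy z)]
      map_smul' := fun c z => by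
        rw [map_smul, LinearMap.smul_apply, smul_eq_mul, Int.mul_ediv_assoc _ (hy z)]
        rfl }
  let b : L →ₗ[ℤ] ℤ :=
    { toFun := fun z => B x z / d
      map_add' := fun z w => by
        rw [map_add, Int.add_ediv_of_dvd_left (hx z)]
      map_smul' := fun c z => by
        rw [map_smul, smul_eq_mul, Int.mul_ediv_assoc _ (hx z)]
        rfl }
  have ha : ∀ z, B z y = d * a z := fun z => (Int.mul_ediv_cancel' (hy z)).symm
  have hb : ∀ z, B x z = d * b z := fun z => (Int.mul_ediv_cancel' (hx z)).symm
  have hyx : B y x = -d := by rw [form_neg hB, hxy]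
  have hax : a x = 1 := mul_left_cancel₀ hd' (by rw [← ha, hxy, mul_one])
  have hby : b y = 1 := mul_left_cancel₀ hd' (by rw [← hb, hxy, mul_one])
  have hay : a y = 0 := mul_left_cancel₀ hd' (by rw [← ha, hB, mul_zero])
  have hbx : b x = 0 := mul_left_cancel₀ hd' (by rw [← hb, hB, mul_zero])
  -- Since a and b are the coordinates dual to x and y, K is the orthogonal complement of the plane,
  -- and z - a(z) x - b(z) y is the integral projection onto it.
  let K : Submodule ℤ L := LinearMap.ker a ⊓ LinearMap.ker b
  let p : L →ₗ[ℤ] K := LinearMap.codRestrict K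
    (LinearMap.id - a.smulRight x - b.smulRight y) fun z => by
      simp [K, hax, hay, hbx, hby]
  have hp : ∀ z, (p z : L) = z - a z • x - b z • y := fun z => rfl
  have hKa : ∀ w : K, a w = 0 := fun w => w.2.1
  have hKb : ∀ w : K, b w = 0 := fun w => w.2.2
  let f₁ : L →ₗ[ℤ] (Fin 2 → ℤ) := LinearMap.pi ![a, b]
  let g₁ : (Fin 2 → ℤ) →ₗ[ℤ] L :=
    (LinearMap.proj 0).smulRight x + (LinearMap.proj 1).smulRight y
  have hg₁ : ∀ c, g₁ c = c 0 • x + c 1 • y := fun c => rfl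
  have hf0 : ∀ z, f₁ z 0 = a z := fun z => rfl
  have hf1 : ∀ z, f₁ z 1 = b z := fun z => rfl
  let f : L ≃ₗ[ℤ] (Fin 2 → ℤ) × K := LinearEquiv.ofLinearMap (f₁.prod p) (g₁.coprod K.subtype)
    (by
      refine LinearMap.ext fun ⟨c, w⟩ => Prod.ext ?_ (Subtype.ext ?_)
      · ext i
        fin_cases i
        · change a (g₁ c + w) = c 0
          simp [hg₁, hax, hay, hKa]
        · change b (g₁ c + w) = c 1
          simp [hg₁, hbx, hby, hKb]
      · change (p (g₁ c + w) : L) = w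
        simp [hp, hg₁, hax, hay, hbx, hby, hKa, hKb])
    (by
      refine LinearMap.ext fun z => ?_
      change g₁ (f₁ z) + (p z : L) = z
      rw [hg₁, hp, hf0, hf1]
      abel)
  refine ⟨d, K, f, fun z w => ?_⟩
  have hz : ∀ z, z = a z • x + b z • y + (p z : L) := fun z => by rw [hp]; abel
  have e1 : ∀ w : K, B x w = 0 := fun w => by rw [hb, hKb, mul_zero]
  have e2 : ∀ w : K, B w y = 0 := fun w => by rw [ha, hKa, mul_zero]
  have e3 : ∀ w : K, B w x = 0 := fun w => by rw [form_neg hB, e1, neg_zero]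
  have e4 : ∀ w : K, B y w = 0 := fun w => by rw [form_neg hB, e2, neg_zero]
  change B z w = planeForm d (f₁ z) (f₁ w) + B (p z) (p w)
  rw [planeForm_apply, hf0, hf1, hf0, hf1]
  conv_lhs => rw [hz z, hz w]
  simp only [map_add, map_smul, LinearMap.add_apply, LinearMap.smul_apply, hB, hxy, hyx, e1, e2,
    e3, e4, smul_eq_mul]
  ring

/-- A rational alternating form on a lattice is an orthogonal sum of a zero form and planes, which
are realised by a tensor product of noncommutative tori. -/
theorem exists_normal_form (N : ℕ) [NeZero N] (m : ℕ) :
    ∀ (L : Type) [AddCommGroup L] [Module.Free ℤ L] [Module.Finite ℤ L]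
      (B : L →ₗ[ℤ] L →ₗ[ℤ] ℤ) (_ : ∀ x, B x x = 0) (_ : Module.finrank ℤ L = m),
    ∃ (k t : ℕ) (r : Fin t → ℚ) (L' : Type) (_ : AddCommGroup L') (_ : Module.Free ℤ L')
      (_ : Module.Finite ℤ L') (B' : L' →ₗ[ℤ] L' →ₗ[ℤ] ℤ) (f : L ≃ₗ[ℤ] (Fin k → ℤ) × L'),
      m = k + 2 * t ∧ (∀ x y, B x y = sumForm 0 B' (f x) (f y)) ∧
      Nonempty (QuantumTorus N B' (bigTensor t fun i => ⟨NCTorus (skew2 (r i : ℝ))⟩).carrier) := by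
  induction m using Nat.strong_induction_on with
  | _ m ih =>
    intro L _ _ _ B hB hm
    by_cases h : B = 0
    · refine ⟨m, 0, Fin.elim0, PUnit, inferInstance, inferInstance, inferInstance, 0,
        (Module.finBasisOfFinrankEq ℤ L hm).equivFun.trans LinearEquiv.prodUnique.symm, by omega,
        fun x y => ?_, ⟨quantumTorusComplex N⟩⟩
      rw [h]
      rfl
    · obtain ⟨d, K, f, hf⟩ := exists_split_plane B hB h
      have hrank : m = 2 + Module.finrank ℤ K := by
        rw [← hm, f.finrank_eq, Module.finrank_prod, Module.finrank_fin_fun]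
      obtain ⟨k, t, r, L', _, _, _, B', g, hk, hg, ⟨Q⟩⟩ := ih (Module.finrank ℤ K) (by omega) K
        (B.compl₁₂ K.subtype K.subtype) (fun x => hB x) rfl
      -- The new plane goes first, both in the list of parameters and in the lattice, to match the
      -- recursion of `bigTensor`; the equivalence moves it past the zero summand ℤᵏ.
      refine ⟨k, t + 1, Fin.cons (d / N) r, (Fin 2 → ℤ) × L', inferInstance, inferInstance,
        inferInstance, sumForm (planeForm d) B',
        f.trans (((LinearEquiv.refl ℤ (Fin 2 → ℤ)).prodCongr g).trans
          ((LinearEquiv.prodAssoc ℤ (Fin 2 → ℤ) (Fin k → ℤ) L').symm.trans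
            (((LinearEquiv.prodComm ℤ (Fin 2 → ℤ) (Fin k → ℤ)).prodCongr
              (LinearEquiv.refl ℤ L')).trans
                (LinearEquiv.prodAssoc ℤ (Fin k → ℤ) (Fin 2 → ℤ) L')))), by omega, fun x y => ?_,
        ⟨(quantumTorusPlane N d).tensor Q⟩⟩
      have h1 : B (f x).2 (f y).2 = sumForm 0 B' (g (f x).2) (g (f y).2) := hg (f x).2 (f y).2
      rw [hf, h1]
      simp only [sumForm_apply, LinearMap.zero_apply, zero_add]
      rfl

end NormalForm

/-- A rational skew-symmetric matrix is the matrix of an integral alternating form, divided by a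
common denominator. -/
theorem exists_formMatrix_eq {n : ℕ} (θ : Matrix (Fin n) (Fin n) ℚ) (hθ : θᵀ = -θ) :
    ∃ (N : ℕ) (_ : NeZero N) (B : (Fin n → ℤ) →ₗ[ℤ] (Fin n → ℤ) →ₗ[ℤ] ℤ),
      (∀ x, B x x = 0) ∧ formMatrix N B = θ.map (fun q : ℚ => (q : ℝ)) := by
  obtain ⟨⟨b, hb⟩, hN⟩ := IsLocalization.exist_integer_multiples_of_finite (nonZeroDivisors ℤ)
    (fun p : Fin n × Fin n => θ p.1 p.2)
  have hb0 : b ≠ 0 := nonZeroDivisors.ne_zero hb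
  have hM : ∀ i j, ∃ m : ℤ, θ i j = m / b.natAbs := fun i j => by
    obtain ⟨m, hm⟩ := hN (i, j)
    have hm' : (m : ℚ) = b * θ i j := by simpa using hm
    have hbq : (b : ℚ) ≠ 0 := by exact_mod_cast hb0
    -- The common denominator b may be negative; its sign is absorbed into the numerator so that N
    -- is a natural number.
    rcases Int.natAbs_eq b with h | h
    · refine ⟨m, ?_⟩
      have h' : (b : ℚ) = b.natAbs := (congrArg Int.cast h).trans (Int.cast_natCast _)
      rw [← h', hm']; field_simp
    · refine ⟨-m, ?_⟩
      have h' : (b.natAbs : ℚ) = -b := by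
        have : (b.natAbs : ℤ) = -b := by omega
        rw [← Int.cast_natCast, this, Int.cast_neg]
      rw [h']; push_cast; rw [hm']; field_simp
  choose M hM using hM
  have hN0 : NeZero b.natAbs := ⟨Int.natAbs_ne_zero.mpr hb0⟩
  have hskew : ∀ i j, M i j = -M j i := fun i j => by
    have h1 := congrFun (congrFun hθ j) i
    rw [Matrix.transpose_apply, Matrix.neg_apply, hM, hM] at h1
    have h2 : (b.natAbs : ℚ) ≠ 0 := by exact_mod_cast hN0.out
    field_simp at h1
    exact_mod_cast h1
  refine ⟨b.natAbs, hN0, Matrix.toLinearMap₂' ℤ (Matrix.of M), fun x => ?_, ?_⟩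
  -- Exchanging the summation indices gives B x x = -B x x, and ℤ has no 2-torsion.
  · have h : Matrix.toLinearMap₂' ℤ (Matrix.of M) x x = -Matrix.toLinearMap₂' ℤ (Matrix.of M) x x := by
      conv_lhs => rw [Matrix.toLinearMap₂'_apply, Finset.sum_comm]
      rw [Matrix.toLinearMap₂'_apply, ← Finset.sum_neg_distrib]
      refine Finset.sum_congr rfl fun i _ => ?_
      rw [← Finset.sum_neg_distrib]
      refine Finset.sum_congr rfl fun j _ => ?_
      simp only [Matrix.of_apply, hskew j i, smul_eq_mul]
      ring
    omega
  · ext i j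
    simp [formMatrix, hM, Matrix.toLinearMap₂'_apply, Pi.single_apply]

end NCT

end

theorem mainTheorem8 (n : ℕ) (θ : Matrix (Fin n) (Fin n) ℚ) (hθ : θᵀ = -θ) :
    ∃ (k t : ℕ) (r : Fin t → ℚ), n = k + 2 * t ∧
      Nonempty (NCT.NCTorus (θ.map (fun q : ℚ => (q : ℝ))) ≃⋆ₐ[ℂ]
        NCT.CStarTensor C(Fin k → Circle, ℂ)
          (NCT.bigTensor t fun i => ⟨NCT.NCTorus (NCT.skew2 (r i : ℝ))⟩).carrier) := by
  obtain ⟨N, _, B, hB, hθB⟩ := NCT.exists_formMatrix_eq θ hθ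
  obtain ⟨k, t, r, L', _, _, _, B', f, hn, hf, ⟨Q⟩⟩ := NCT.exists_normal_form N n (Fin n → ℤ) B hB
    (Module.finrank_fin_fun ℤ)
  refine ⟨k, t, r, hn, ?_⟩
  rw [← hθB]
  -- Transported along f, the tensor product is a quantum torus over ℤⁿ for the same form B, so
  -- uniqueness applies.
  exact (NCT.quantumTorusNCTorus N B hB).nonempty_equiv
    (((NCT.quantumTorusCircle N k).tensor Q).congr f B hf)
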